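/- **Theorem (Coupling from the past).** Let $E$ be a Radon topological space (homeomorphic to a universally measurable subset of a compact metric space) with its Borel $\sigma$-algebra and a $\sigma$-finite Radon measure $m$. Let $Y$ be a right process (in Sharpe's sense, with infinite lifetime) on $E$ with laws $\mathbb P^0_x$, $x\in E$, and write $\mathbb P^0_\nu=\int\nu(dx)\,\mathbb P^0_x$. Let $\kappa:E\to[0,\infty)$ be measurable and locally bounded, and let $\mu\ge 0$ be a probability density with respect to $m$, with $\nu_\mu(dx)=\mu(x)\,m(dx)$. For a rate $\kappa$, a path $y$ and $\xi\ge0$ put $\tau_\kappa(y,\xi)=\inf\{t\ge 0:\int_0^t\kappa(y_s)\,ds\ge\xi\}$ (with $\inf\varnothing=\infty$). The *Restore process* with interarrival dynamics $Y$, regeneration rate $\kappa$, regeneration density $\mu$ and initial distribution $\nu_0$ is $$X_t=\sum_{i\ge 0}1_{[T_i,T_{i+1})}(t)\,Y^{(i)}_{t-T_i},\qquad T_n=\sum_{i<n}\tau_\kappa(Y^{(i)},\xi^{(i)}),$$ where the pairs $(Y^{(i)},\xi^{(i)})$, $i\ge0$, are independent, $\xi^{(i)}\sim\mathrm{Exp}(1)$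 is independent of $Y^{(i)}$, $Y^{(0)}\sim\mathbb P^0_{\nu_0}$ and $Y^{(i)}\sim\mathbb P^0_{\nu_\mu}$ for $i\ge 1$. Its transition probabilities $P_t(x,\cdot)$ are the laws of $X_t$ for $\nu_0=\delta_x$. A measure $\pi$ is invariant if $\pi P_t=\pi$ for all $t\ge 0$. The process is irreducible if there is a nonzero $\sigma$-finite measure $\varphi$ on $E$ such that $\varphi(B)>0$ implies $\int_0^\infty P_t(x,B)\,dt>0$ for every $x\in E$. Assume that the Restore process with rate $\kappa$ and density $\mu$ is irreducible, and that there is a constant $\underline\kappa>0$ with $\kappa\ge\underline\kappa$ $m$-almost everywhere and such that the modified rate $\kappa'=\kappa-\underline\kappa$ is nonnegative along $Y$ started from $\nu_\mu$: $\mathbb P^0_{\nu_\mu}$-almost surely, $\kappa(Y_t)\ge\underline\kappa$ for Lebesgue-almost every $t\ge 0$. (The last condition holds in particular if $\kappa\ge\underline\kappa$ everywhere on $E$, or if $\kappa\ge\underline\kappa$ $m$-almost everywhere and the law of $Y_t$ under $\mathbb P^0_{\nu_\mu}$ is absolutely continuous with respect to $m$ for almost every $t$. Where $\kappa<\underline\kappa$,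 $\kappa'$ is read as $0$.) Then the Restore process with rate $\kappa$ and density $\mu$ has a unique invariant probability distribution $\pi$. Moreover, if $X$ is the Restore process with interarrival dynamics $Y$, modified regeneration rate $\kappa'$, regeneration density $\mu$ and initial distribution $X_0\sim\nu_\mu$, and if $T\sim\mathrm{Exp}(\underline\kappa)$ is independent of $X$, then $$X_T\sim\pi .$$ -/

import Mathlib

open MeasureTheory ProbabilityTheory Filter Topology Set
open scoped NNReal ENNReal

noncomputable section

/-- A map on a measurable space is universally measurable if it is almost everywhere measurable
for every finite measure. -/
def UniversallyMeasurable {E F : Type*} [MeasurableSpace E] [MeasurableSpace F] (f : E → F) :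
    Prop :=
  ∀ ν : Measure E, IsFiniteMeasure ν → AEMeasurable f ν

/-- A Radon topological space: a space homeomorphic to a universally measurable subset of a compact
metric space.  (Compact metric spaces have at most continuum many points, so those in `Type` are
all of them.) -/
def IsRadonSpace (E : Type*) [TopologicalSpace E] : Prop :=
  ∃ (K : Type) (_ : MetricSpace K) (_ : CompactSpace K) (_ : MeasurableSpace K) (_ : BorelSpace K)
    (e : E → K), IsEmbedding e ∧
      ∀ ν : Measure K, IsFiniteMeasure ν → NullMeasurableSet (range e) ν

/-! ### Right-continuous paths -/

/-- Right-continuous paths `[0, ∞) → E`, with the σ-algebra generated by the coordinates. -/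
abbrev RCPath (E : Type*) [TopologicalSpace E] : Type _ :=
  {y : ℝ≥0 → E // ∀ t, ContinuousWithinAt y (Ici t) t}

namespace RCPath

variable {E : Type*} [TopologicalSpace E]

/-- The path after time `s`. -/
def shift (s : ℝ≥0) (y : RCPath E) : RCPath E :=
  ⟨fun t => y.1 (s + t), fun t => by
    have h : ContinuousWithinAt (fun r : ℝ≥0 => s + r) (Ici t) t :=
      (continuous_const.add continuous_id).continuousWithinAt
    exact (y.2 (s + t)).comp h fun r hr => by
      simpa using hr⟩

/-- The σ-algebra generated by the coordinates up to time `s`. -/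
@[reducible] def past [MeasurableSpace E] (s : ℝ≥0) : MeasurableSpace (RCPath E) :=
  ⨆ r ∈ Iic s, MeasurableSpace.comap (fun y : RCPath E => y.1 r) inferInstance

end RCPath

/-! ### Right processes -/

/-- `f` is `α`-excessive for the transition semigroup `P_t f (x) = E_x[f(Y_t)]` of a family `P` of
path laws: `f` is universally measurable with values in `[0, ∞]`, `exp (-α t) P_t f ≤ f`, and
`exp (-α t) P_t f → f` pointwise as `t ↓ 0`. -/
def IsExcessive {E : Type*} [TopologicalSpace E] [MeasurableSpace E]
    (P : E → Measure (RCPath E)) (α : ℝ≥0) (f : E → ℝ≥0∞) : Prop :=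
  UniversallyMeasurable f ∧
  (∀ (t : ℝ≥0) (x : E),
    ENNReal.ofReal (Real.exp (-((α : ℝ) * t))) * ∫⁻ y, f (y.1 t) ∂(P x) ≤ f x) ∧
  ∀ x : E, Tendsto
    (fun t : ℝ≥0 => ENNReal.ofReal (Real.exp (-((α : ℝ) * t))) * ∫⁻ y, f (y.1 t) ∂(P x))
    (𝓝[>] 0) (𝓝 (f x))

/-- A (conservative) right process on `E`, given by the laws `law x` that it induces, for the
starting points `x`, on the space of right-continuous paths. -/
structure RightProcess (E : Type*) [TopologicalSpace E] [MeasurableSpace E] where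
  /-- the law of the process started at `x` -/
  law : E → Measure (RCPath E)
  /-- each `law x` is a probability measure -/
  prob : ∀ x, IsProbabilityMeasure (law x)
  /-- `x ↦ law x` is universally measurable -/
  meas : UniversallyMeasurable law
  /-- the process under `law x` starts at `x` -/
  normal : ∀ x, ∀ᵐ y ∂(law x), y.1 0 = x
  /-- Markov property -/
  markov : ∀ (x : E) (s : ℝ≥0) (A B : Set (RCPath E)),
    MeasurableSet[RCPath.past s] A → MeasurableSet B →
      law x (A ∩ RCPath.shift s ⁻¹' B) = ∫⁻ y in A, law (y.1 s) B ∂(law x)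
  /-- for every initial distribution, excessive functions are almost surely right-continuous along
  the paths; this contains the strong Markov property -/
  excessive : ∀ (α : ℝ≥0) (f : E → ℝ≥0∞), IsExcessive law α f →
    ∀ ν : Measure E, IsProbabilityMeasure ν →
      ∀ᵐ y ∂(ν.bind law), ∀ t : ℝ≥0, ContinuousWithinAt (fun s => f (y.1 s)) (Ici t) t

namespace RightProcess

variable {E : Type*} [TopologicalSpace E] [MeasurableSpace E]

/-- The law of the process with initial distribution `ν`. -/
def lawFrom (Y : RightProcess E) (ν : Measure E) : Measure (RCPath E) := ν.bind Y.law

theorem isProbabilityMeasure_lawFrom (Y : RightProcess E) (ν : Measure E)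
    [IsProbabilityMeasure ν] : IsProbabilityMeasure (Y.lawFrom ν) :=
  isProbabilityMeasure_bind (Y.meas ν inferInstance) (Eventually.of_forall Y.prob)

end RightProcess

/-! ### The Restore process -/

section Restore

variable {E : Type*} [TopologicalSpace E]

/-- The accumulated rate `∫₀ᵗ κ(y_s) ds`. -/
def cumRate (κ : E → ℝ≥0) (y : RCPath E) (t : ℝ≥0) : ℝ≥0∞ :=
  ∫⁻ s in Icc (0 : ℝ) t, (κ (y.1 s.toNNReal) : ℝ≥0∞)

/-- The lifetime `inf {t ≥ 0 : ∫₀ᵗ κ(y_s) ds ≥ ξ}`, equal to `∞` if there is no such `t`. -/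
def lifetime (κ : E → ℝ≥0) (y : RCPath E) (ξ : ℝ) : ℝ≥0∞ :=
  ⨅ (t : ℝ≥0) (_ : ENNReal.ofReal ξ ≤ cumRate κ y t), (t : ℝ≥0∞)

/-- The `n`-th regeneration time, the sum of the first `n` lifetimes, for a sequence `z` of pairs
of a path and an exponential clock. -/
def regenTime (κ : E → ℝ≥0) (z : ℕ → RCPath E × ℝ) (n : ℕ) : ℝ≥0∞ :=
  ∑ i ∈ Finset.range n, lifetime κ (z i).1 (z i).2

/-- The index `i` of the tour with `T_i ≤ t < T_{i+1}` (and `0` if there is none). -/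
def tourIndex (κ : E → ℝ≥0) (z : ℕ → RCPath E × ℝ) (t : ℝ≥0) : ℕ :=
  sInf {i : ℕ | (t : ℝ≥0∞) < regenTime κ z (i + 1)}

/-- The path `X_t = ∑ᵢ 1_{[T_i, T_{i+1})}(t) Y^{(i)}_{t - T_i}` of the Restore process; see
`restorePath_eq`. -/
def restorePath (κ : E → ℝ≥0) (z : ℕ → RCPath E × ℝ) (t : ℝ≥0) : E :=
  (z (tourIndex κ z t)).1.1 ((t : ℝ≥0∞) - regenTime κ z (tourIndex κ z t)).toNNReal

theorem regenTime_mono (κ : E → ℝ≥0) (z : ℕ → RCPath E × ℝ) : Monotone (regenTime κ z) :=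
  fun _ _ h => Finset.sum_le_sum_of_subset (Finset.range_mono h)

theorem restorePath_eq (κ : E → ℝ≥0) (z : ℕ → RCPath E × ℝ) (t : ℝ≥0) (i : ℕ)
    (h₁ : regenTime κ z i ≤ t) (h₂ : (t : ℝ≥0∞) < regenTime κ z (i + 1)) :
    restorePath κ z t = (z i).1.1 ((t : ℝ≥0∞) - regenTime κ z i).toNNReal := by
  have h : tourIndex κ z t = i := by
    refine le_antisymm (Nat.sInf_le h₂) ?_
    refine le_csInf ⟨i, h₂⟩ fun j hj => ?_
    by_contra hji
    have : regenTime κ z (j + 1) ≤ regenTime κ z i := regenTime_mono κ z (by omega)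
    exact absurd (lt_of_lt_of_le hj (this.trans h₁)) (lt_irrefl _)
  rw [restorePath, h]

variable [MeasurableSpace E]

/-- The joint law of `(Y, ξ)` for a path `Y` with law `Q` and an independent clock `ξ ~ Exp(1)`. -/
def clockedLaw (Q : Measure (RCPath E)) : Measure (RCPath E × ℝ) := Q.prod (expMeasure 1)

/-- The law of the sequence `(Y^{(i)}, ξ^{(i)})` of independent pairs that drives the Restore process
started at `x` with regeneration distribution `ν`. -/
def driverLaw (Y : RightProcess E) (ν : Measure E) (x : E) : Measure (ℕ → RCPath E × ℝ) :=
  Measure.infinitePi fun i => clockedLaw (if i = 0 then Y.law x else Y.lawFrom ν)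

theorem isProbabilityMeasure_driverLaw (Y : RightProcess E) (ν : Measure E)
    [IsProbabilityMeasure ν] (x : E) : IsProbabilityMeasure (driverLaw Y ν x) := by
  have h0 := Y.prob x
  have h1 := Y.isProbabilityMeasure_lawFrom ν
  have h2 : IsProbabilityMeasure (expMeasure 1) := isProbabilityMeasure_expMeasure one_pos
  have : ∀ i : ℕ, IsProbabilityMeasure
      (clockedLaw (if i = 0 then Y.law x else Y.lawFrom ν)) := fun i => by
    unfold clockedLaw
    split_ifs <;> infer_instance
  unfold driverLaw
  infer_instance

/-- The transition probabilities `P_t(x, ·)` of the Restore process with interarrival dynamics `Y`,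
regeneration rate `κ` and regeneration distribution `ν`. -/
def restoreTransition (Y : RightProcess E) (κ : E → ℝ≥0) (ν : Measure E) (t : ℝ≥0) (x : E) :
    Measure E :=
  (driverLaw Y ν x).map fun z => restorePath κ z t

/-- `π P_t = π` for all `t ≥ 0`. -/
def IsRestoreInvariant (Y : RightProcess E) (κ : E → ℝ≥0) (ν π : Measure E) : Prop :=
  ∀ (t : ℝ≥0) (B : Set E), MeasurableSet B → ∫⁻ x, restoreTransition Y κ ν t x B ∂π = π B

/-- Irreducibility: for some nonzero σ-finite measure `φ`, every set charged by `φ` has positive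
expected occupation time from every starting point. -/
def IsRestoreIrreducible (Y : RightProcess E) (κ : E → ℝ≥0) (ν : Measure E) : Prop :=
  ∃ φ : Measure E, SigmaFinite φ ∧ φ ≠ 0 ∧ ∀ B : Set E, MeasurableSet B → 0 < φ B →
    ∀ x : E, 0 < ∫⁻ t in Ici (0 : ℝ), restoreTransition Y κ ν t.toNNReal x B

/-- The random sequence `z` consists of independent pairs `(Y^{(i)}, ξ^{(i)})`, each of a copy of `Y`
with initial distribution `ν` and an independent clock `ξ^{(i)} ~ Exp(1)`; that is, `z` drives a
Restore process with initial and regeneration distribution `ν`. -/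
structure DrivesRestore (Y : RightProcess E) (ν : Measure E) {Ω : Type*} [MeasurableSpace Ω]
    (Pr : Measure Ω) (z : ℕ → Ω → RCPath E × ℝ) : Prop where
  measurable : ∀ i, Measurable (z i)
  law : ∀ i, Pr.map (z i) = clockedLaw (Y.lawFrom ν)
  indep : iIndepFun z Pr

end Restore

end

/-! Let Q be the law of Y started from ν, and let ρ(B) = ∫ E_Q[exp(-∫₀ˢ κ(Y)) 1_B(Y_s)] ds be the
expected occupation measure of one tour (`tourOccupation`). Existence and the formula for X_T both
come from ρ: it is invariant for the rate κ, and its normalisation is the law of X_T.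

Invariance (`lintegral_restoreTransition_tourOccupation`). By the Markov property of Y and the
memorylessness of the clock, restarting at Y_s with the weight of survival up to s amounts to
continuing the same tour. Hence ρP_t f = ∫_t^∞ g + W, where g(s) = E_Q[exp(-∫₀ˢ κ) f(Y_s)] and W
collects what happens after the next regeneration. With u(r) = E f(X_r) and lifetime τ, the renewal
equation u(r) = g(r) + E[u(r - τ); τ ≤ r], integrated over [0, t), yields W = ∫₀ᵗ g. This needs τ
finite almost surely, which the lower bound on the rate guarantees.

Exponential time (`lintegral_restoreMean_expMeasure`, `restoreExpLaw_eq`). Write r for the lower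
bound and τ' for the lifetime at rate κ'. Along almost every path ∫₀ᵗ κ = ∫₀ᵗ κ' + rt, so
integrating the renewal equation of the κ'-process against r exp(-rt) dt gives L = rρ(B) + qL, where
L = P(X_T ∈ B) and q = E exp(-rτ') < 1. Thus the law of X_T is a multiple of ρ, and B = E shows that
ρ is finite.

Uniqueness (`IsRestoreInvariant.unique`). The minimum of two invariant probabilities is invariant,
so the two excesses over it are invariant and mutually singular. By irreducibility a nonzero
invariant measure charges every set that φ charges, so the excesses cannot both be nonzero. -/

/-! ### Integration over the time axis `[0, ∞)` -/

/-- Lebesgue measure on `[0, ∞)`. -/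
noncomputable def timeMeasure : Measure ℝ≥0 := (volume.restrict (Ici (0 : ℝ))).map Real.toNNReal

theorem lintegral_timeMeasure {f : ℝ≥0 → ℝ≥0∞} (hf : Measurable f) :
    ∫⁻ t, f t ∂timeMeasure = ∫⁻ t in Ici (0 : ℝ), f t.toNNReal :=
  lintegral_map hf measurable_real_toNNReal

theorem timeMeasure_apply {s : Set ℝ≥0} (hs : MeasurableSet s) :
    timeMeasure s = volume ((↑) '' s : Set ℝ) := by
  rw [timeMeasure, Measure.map_apply measurable_real_toNNReal hs,
    Measure.restrict_apply (measurable_real_toNNReal hs)]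
  congr 1
  ext x
  simp only [mem_inter_iff, mem_preimage, mem_Ici, mem_image]
  constructor
  · rintro ⟨h, h0⟩
    exact ⟨_, h, Real.coe_toNNReal x h0⟩
  · rintro ⟨y, hy, rfl⟩
    simpa using hy

theorem timeMeasure_Iio (t : ℝ≥0) : timeMeasure (Iio t) = t := by
  rw [timeMeasure_apply measurableSet_Iio]
  have : ((↑) '' Iio t : Set ℝ) = Ico 0 (t : ℝ) := by
    ext x
    constructor
    · rintro ⟨y, hy, rfl⟩
      exact ⟨y.2, by exact_mod_cast hy⟩
    · rintro ⟨h0, h1⟩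
      exact ⟨⟨x, h0⟩, by exact_mod_cast h1, rfl⟩
  rw [this]
  simp

instance : SigmaFinite timeMeasure := by
  refine ⟨⟨⟨fun n => Iio (n : ℝ≥0), fun _ => trivial, fun n => ?_, ?_⟩⟩⟩
  · rw [timeMeasure_Iio]; exact ENNReal.coe_lt_top
  · refine eq_univ_of_forall fun x => mem_iUnion.2 ?_
    obtain ⟨n, hn⟩ := exists_nat_gt x
    exact ⟨n, hn⟩

/-- Translation invariance of Lebesgue measure on the line, for `f` extended by zero to negative
times. -/
theorem lintegral_timeMeasure_add (a : ℝ≥0) {f : ℝ≥0 → ℝ≥0∞} (hf : Measurable f) :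
    ∫⁻ t, f (a + t) ∂timeMeasure = ∫⁻ t in Ici a, f t ∂timeMeasure := by
  rw [lintegral_timeMeasure (f := fun t => f (a + t)) (hf.comp (measurable_const_add a)),
    ← lintegral_indicator measurableSet_Ici, ← lintegral_indicator (μ := timeMeasure)
    measurableSet_Ici, lintegral_timeMeasure (hf.indicator measurableSet_Ici),
    ← lintegral_indicator measurableSet_Ici,
    ← lintegral_add_left_eq_self (fun t : ℝ => (Ici (0 : ℝ)).indicator
      (fun t => (Ici a).indicator f t.toNNReal) t) (a : ℝ)]
  congr 1
  ext t
  rcases le_or_gt 0 t with ht | ht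
  · lift t to ℝ≥0 using ht
    have h : ((a : ℝ) + t).toNNReal = a + t := by
      rw [← NNReal.coe_add, Real.toNNReal_coe]
    rw [indicator_of_mem (by simp), indicator_of_mem (by simp; positivity)]
    simp [h]
  · rw [indicator_of_notMem (by simpa using ht)]
    by_cases h : (a : ℝ) + t ∈ Ici (0 : ℝ)
    · rw [indicator_of_mem h, indicator_of_notMem]
      rw [mem_Ici, Real.le_toNNReal_iff_coe_le h]
      linarith
    · rw [indicator_of_notMem h]

/-! ### Exponential clocks -/

theorem lintegral_expMeasure {r : ℝ} {f : ℝ≥0 → ℝ≥0∞} (hf : Measurable f) :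
    ∫⁻ ξ, f ξ.toNNReal ∂(expMeasure r) =
      ∫⁻ t, ENNReal.ofReal (r * Real.exp (-(r * t))) * f t ∂timeMeasure := by
  have h1 : Measurable (fun t : ℝ≥0 => ENNReal.ofReal (r * Real.exp (-(r * t))) * f t) := by
    fun_prop
  have h2 : Measurable (exponentialPDF r) := (measurable_exponentialPDFReal r).ennreal_ofReal
  rw [lintegral_timeMeasure h1]
  change ∫⁻ ξ, f ξ.toNNReal ∂(volume.withDensity (exponentialPDF r)) = _
  rw [lintegral_withDensity_eq_lintegral_mul _ h2 (g := fun ξ => f ξ.toNNReal)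
    (hf.comp measurable_real_toNNReal),
    ← lintegral_indicator measurableSet_Ici]
  congr 1
  ext t
  rcases le_or_gt 0 t with ht | ht
  · rw [indicator_of_mem (by simpa using ht), Pi.mul_apply, exponentialPDF_of_nonneg ht,
      Real.coe_toNNReal t ht]
  · rw [indicator_of_notMem (by simpa using ht), Pi.mul_apply, exponentialPDF_of_neg ht, zero_mul]

instance : IsProbabilityMeasure (expMeasure 1) := isProbabilityMeasure_expMeasure one_pos

/-- The probability that an `Exp(1)` clock exceeds `a`. -/
noncomputable def expTail (a : ℝ≥0∞) : ℝ≥0∞ := expMeasure 1 {ξ | a < ENNReal.ofReal ξ}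

theorem measurableSet_lt_ofReal (a : ℝ≥0∞) : MeasurableSet {ξ : ℝ | a < ENNReal.ofReal ξ} :=
  measurableSet_lt measurable_const ENNReal.measurable_ofReal

theorem expTail_antitone : Antitone expTail := fun _ _ h =>
  measure_mono fun _ hξ => lt_of_le_of_lt h hξ

theorem measurable_expTail : Measurable expTail := expTail_antitone.measurable

theorem expTail_le_one (a : ℝ≥0∞) : expTail a ≤ 1 := prob_le_one

theorem expTail_top : expTail ∞ = 0 := by simp [expTail]

theorem ae_expMeasure_pos : ∀ᵐ ξ ∂(expMeasure 1), 0 < ξ := by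
  have : ∀ᵐ ξ ∂(volume.withDensity (exponentialPDF 1)), 0 < ξ := by
    have h2 : Measurable (exponentialPDF 1) := (measurable_exponentialPDFReal 1).ennreal_ofReal
    rw [ae_withDensity_iff h2]
    have h0 : ∀ᵐ ξ : ℝ, ξ ≠ 0 := Measure.ae_ne volume 0
    filter_upwards [h0] with ξ h hξ
    by_contra hn
    exact hξ (exponentialPDF_of_neg (lt_of_le_of_ne (not_lt.1 hn) h))
  exact this

/-- The density satisfies e^{-(a+t)} = e^{-a} e^{-t}, so the substitution t ↦ a + t splits off a
constant. -/
theorem lintegral_expMeasure_tail_coe (a : ℝ≥0) {f : ℝ≥0∞ → ℝ≥0∞} (hf : Measurable f) :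
    ∫⁻ ξ in {ξ | (a : ℝ≥0∞) < ENNReal.ofReal ξ}, f (ENNReal.ofReal ξ - a) ∂(expMeasure 1) =
      ENNReal.ofReal (Real.exp (-a)) * ∫⁻ ξ, f (ENNReal.ofReal ξ) ∂(expMeasure 1) := by
  have hg : Measurable fun t : ℝ≥0 => (Ioi a).indicator (fun t : ℝ≥0 => f (t - a)) t :=
    (by fun_prop : Measurable fun t : ℝ≥0 => f (t - a)).indicator measurableSet_Ioi
  have h1 : ∫⁻ ξ in {ξ | (a : ℝ≥0∞) < ENNReal.ofReal ξ}, f (ENNReal.ofReal ξ - a) ∂(expMeasure 1)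
      = ∫⁻ ξ, (fun t : ℝ≥0 => (Ioi a).indicator (fun t : ℝ≥0 => f (t - a)) t) ξ.toNNReal
        ∂(expMeasure 1) := by
    rw [← lintegral_indicator (measurableSet_lt_ofReal _)]
    congr 1
    ext ξ
    simp only [indicator, mem_ofPred_eq, ENNReal.ofReal, mem_Ioi, ENNReal.coe_lt_coe]
  -- The substitution carries the strict condition ξ > a to t > 0. The indicator of t > 0 costs
  -- nothing because the clock is almost surely positive.
  have h2 : ∫⁻ ξ, f (ENNReal.ofReal ξ) ∂(expMeasure 1)
      = ∫⁻ ξ, (fun t : ℝ≥0 => (Ioi 0).indicator (fun t : ℝ≥0 => f t) t) ξ.toNNReal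
        ∂(expMeasure 1) := by
    refine lintegral_congr_ae ?_
    filter_upwards [ae_expMeasure_pos] with ξ hξ
    rw [indicator_of_mem (by simpa using hξ)]
    rfl
  have hg' : Measurable fun t : ℝ≥0 => (Ioi 0).indicator (fun t : ℝ≥0 => f t) t :=
    (by fun_prop : Measurable fun t : ℝ≥0 => f t).indicator measurableSet_Ioi
  rw [h1, h2, lintegral_expMeasure hg, lintegral_expMeasure hg',
    ← lintegral_const_mul _ (by fun_prop)]
  have h3 := lintegral_timeMeasure_add a (f := fun t => ENNReal.ofReal (1 * Real.exp (-(1 * t))) *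
    (Ioi a).indicator (fun t : ℝ≥0 => f (t - a)) t) (by fun_prop)
  rw [← lintegral_indicator measurableSet_Ici] at h3
  trans ∫⁻ t : ℝ≥0, (fun t : ℝ≥0 => ENNReal.ofReal (1 * Real.exp (-(1 * t))) *
    (Ioi a).indicator (fun t : ℝ≥0 => f (t - a)) t) (a + t) ∂timeMeasure
  · rw [h3]
    congr 1
    ext t
    by_cases h : t ∈ Ici a
    · rw [indicator_of_mem h]
    · rw [indicator_of_notMem h, indicator_of_notMem, mul_zero]
      exact fun h' => h (mem_Ici.2 (le_of_lt h'))
  · congr 1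
    ext t
    beta_reduce
    rw [← mul_assoc, ← ENNReal.ofReal_mul (by positivity)]
    congr 1
    · push_cast
      simp only [one_mul]
      rw [← Real.exp_add]
      ring_nf
    · simp [indicator]

theorem expTail_coe (a : ℝ≥0) : expTail a = ENNReal.ofReal (Real.exp (-a)) := by
  have h := lintegral_expMeasure_tail_coe a (f := fun _ => 1) measurable_const
  simpa [expTail] using h

/-- An `Exp(1)` clock is memoryless. -/
theorem lintegral_expMeasure_tail (a : ℝ≥0∞) {f : ℝ≥0∞ → ℝ≥0∞} (hf : Measurable f) :
    ∫⁻ ξ in {ξ | a < ENNReal.ofReal ξ}, f (ENNReal.ofReal ξ - a) ∂(expMeasure 1) =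
      expTail a * ∫⁻ ξ, f (ENNReal.ofReal ξ) ∂(expMeasure 1) := by
  induction a with
  | top => simp [expTail_top]
  | coe a => rw [lintegral_expMeasure_tail_coe a hf, expTail_coe]

/-- Memorylessness for an indicator: the excess over `a` exceeds `b` exactly when the clock exceeds
`a + b`. With `expTail ∞ = 0`, this treats e^{-a} on all of [0, ∞]. -/
theorem expTail_add (a b : ℝ≥0∞) : expTail (a + b) = expTail a * expTail b := by
  have h := lintegral_expMeasure_tail a (f := (Ioi b).indicator 1)
    (measurable_one.indicator measurableSet_Ioi)
  rw [← lintegral_indicator (measurableSet_lt_ofReal _)] at h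
  have h1 : ∀ ξ : ℝ, {ξ | a < ENNReal.ofReal ξ}.indicator
      (fun ξ => (Ioi b).indicator 1 (ENNReal.ofReal ξ - a)) ξ =
      {ξ | a + b < ENNReal.ofReal ξ}.indicator (1 : ℝ → ℝ≥0∞) ξ := by
    intro ξ
    simp only [indicator, mem_ofPred_eq, mem_Ioi, lt_tsub_iff_left, Pi.one_apply]
    split_ifs with h1 h2 h2 <;> try rfl
    exact absurd (lt_of_le_of_lt le_self_add h2) h1
  have h2 : ∀ ξ : ℝ, (Ioi b).indicator 1 (ENNReal.ofReal ξ) =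
      {ξ | b < ENNReal.ofReal ξ}.indicator (1 : ℝ → ℝ≥0∞) ξ := fun ξ => by
    simp only [indicator, mem_ofPred_eq, mem_Ioi, Pi.one_apply]
  simp_rw [h1, h2] at h
  rwa [lintegral_indicator_one (measurableSet_lt_ofReal _),
    lintegral_indicator_one (measurableSet_lt_ofReal _)] at h

theorem expTail_pos {a : ℝ≥0∞} (ha : a ≠ ∞) : 0 < expTail a := by
  lift a to ℝ≥0 using ha
  rw [expTail_coe]
  positivity

/-! ### Right-continuous functions of time -/

/-- The grid point `(⌊n t⌋ + 1) / n`, for `n` replaced by `n + 1`. -/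
noncomputable def gridAbove (n : ℕ) (t : ℝ≥0) : ℝ≥0 := (⌊((n : ℝ≥0) + 1) * t⌋₊ + 1) / (n + 1)

theorem lt_gridAbove (n : ℕ) (t : ℝ≥0) : t < gridAbove n t := by
  rw [gridAbove, lt_div_iff₀ (by positivity), mul_comm]
  exact Nat.lt_floor_add_one _

theorem gridAbove_le (n : ℕ) (t : ℝ≥0) : gridAbove n t ≤ t + 1 / (n + 1) := by
  rw [gridAbove, div_le_iff₀ (by positivity), add_mul t, div_mul_cancel₀ _ (by positivity),
    mul_comm t]
  gcongr
  exact Nat.floor_le (by positivity)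

theorem tendsto_gridAbove (t : ℝ≥0) :
    Tendsto (fun n => gridAbove n t) atTop (𝓝[≥] t) := by
  refine tendsto_nhdsWithin_iff.2 ⟨?_, Eventually.of_forall fun n => (lt_gridAbove n t).le⟩
  refine tendsto_of_tendsto_of_tendsto_of_le_of_le tendsto_const_nhds ?_
    (fun n => (lt_gridAbove n t).le) fun n => gridAbove_le n t
  have : Tendsto (fun n : ℕ => 1 / ((n : ℝ≥0) + 1)) atTop (𝓝 0) :=
    tendsto_one_div_add_atTop_nhds_zero_nat
  simpa using tendsto_const_nhds.add this

/-- At grid times the process is read at only countably many instants, so measurability of each `X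
t` is enough. -/
theorem measurable_apply_gridAbove {Ω E : Type*} [MeasurableSpace Ω] [MeasurableSpace E]
    {X : ℝ≥0 → Ω → E} (hX : ∀ t, Measurable (X t)) (n : ℕ) :
    Measurable fun p : Ω × ℝ≥0 => X (gridAbove n p.2) p.1 := by
  have h1 (q : ℕ → ℝ≥0) (k : ℝ≥0 → ℕ) (hk : Measurable k) :
      Measurable fun p : Ω × ℝ≥0 => X (q (k p.2)) p.1 := by
    have h2 : Measurable fun p : Ω × ℕ => X (q p.2) p.1 :=
      measurable_from_prod_countable_left fun k => hX (q k)
    exact h2.comp (measurable_fst.prodMk (hk.comp measurable_snd))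
  unfold gridAbove
  exact h1 (fun k => ((k : ℝ≥0) + 1) / (n + 1)) (fun t => ⌊((n : ℝ≥0) + 1) * t⌋₊)
    (Nat.measurable_floor.comp (measurable_id.const_mul _))

/-- A right-continuous process is jointly measurable. -/
theorem measurable_uncurry_of_rightContinuous {Ω E : Type*} [MeasurableSpace Ω]
    [TopologicalSpace E] [TopologicalSpace.PseudoMetrizableSpace E] [MeasurableSpace E]
    [BorelSpace E]
    {X : ℝ≥0 → Ω → E} (hX : ∀ t, Measurable (X t))
    (hc : ∀ ω t, ContinuousWithinAt (fun s => X s ω) (Ici t) t) :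
    Measurable fun p : Ω × ℝ≥0 => X p.2 p.1 :=
  measurable_of_tendsto_metrizable (measurable_apply_gridAbove hX)
    (tendsto_pi_nhds.2 fun p => (hc p.1 p.2).tendsto.comp (tendsto_gridAbove p.2))

/-! ### Measurability of paths and rates -/

section Rates

variable {E : Type*} [TopologicalSpace E]

theorem cumRate_mono (κ : E → ℝ≥0) (y : RCPath E) : Monotone (cumRate κ y) := fun _ _ h =>
  lintegral_mono_set (Icc_subset_Icc_right (by exact_mod_cast h))

theorem cumRate_zero (κ : E → ℝ≥0) (y : RCPath E) : cumRate κ y 0 = 0 := by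
  simp [cumRate]

/-- The rate is bounded near every point. -/
def LocallyBounded (κ : E → ℝ≥0) : Prop := ∀ x, ∃ U ∈ 𝓝 x, BddAbove (κ '' U)

/-- The lifetime as a function of the level `a` that the accumulated rate has to reach. -/
noncomputable def hittingTime (κ : E → ℝ≥0) (y : RCPath E) (a : ℝ≥0∞) : ℝ≥0∞ :=
  ⨅ (t : ℝ≥0) (_ : a ≤ cumRate κ y t), (t : ℝ≥0∞)

theorem hittingTime_le {κ : E → ℝ≥0} {y : RCPath E} {a : ℝ≥0∞} {t : ℝ≥0}
    (h : a ≤ cumRate κ y t) : hittingTime κ y a ≤ t := iInf₂_le t h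

end Rates

section Paths

variable {E : Type*} [TopologicalSpace E] [MeasurableSpace E]

theorem RCPath.measurable_apply (t : ℝ≥0) : Measurable fun y : RCPath E => y.1 t :=
  (measurable_pi_apply t).comp measurable_subtype_coe

theorem RCPath.measurable_shift (s : ℝ≥0) : Measurable (RCPath.shift (E := E) s) :=
  Measurable.subtype_mk (measurable_pi_lambda _ fun t => RCPath.measurable_apply (s + t))

theorem RCPath.past_le (s : ℝ≥0) :
    RCPath.past (E := E) s ≤ (inferInstance : MeasurableSpace (RCPath E)) :=
  iSup₂_le fun r _ => (RCPath.measurable_apply r).comap_le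

variable [BorelSpace E] [TopologicalSpace.PseudoMetrizableSpace E]

theorem RCPath.measurable_eval : Measurable fun p : RCPath E × ℝ≥0 => p.1.1 p.2 :=
  measurable_uncurry_of_rightContinuous (X := fun t (y : RCPath E) => y.1 t)
    RCPath.measurable_apply fun y t => y.2 t

theorem RCPath.measurable_path (y : RCPath E) : Measurable y.1 :=
  RCPath.measurable_eval.comp measurable_prodMk_left

/-- The path frozen at time `s` is again right-continuous, and its coordinates belong to the past of
`s`; hence joint measurability holds already for this smaller σ-algebra. -/
theorem RCPath.measurable_past_eval (s : ℝ≥0) :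
    Measurable[(RCPath.past s).prod inferInstance] fun p : RCPath E × ℝ≥0 => p.1.1 (min p.2 s) := by
  refine @measurable_uncurry_of_rightContinuous (RCPath E) E (RCPath.past s) _ _ _ _
    (fun t y => y.1 (min t s)) (fun t => ?_) fun y t => ?_
  · refine Measurable.of_comap_le ?_
    exact le_iSup₂_of_le (min t s) (min_le_right t s) le_rfl
  · have h : ContinuousWithinAt (fun r : ℝ≥0 => min r s) (Ici t) t := by fun_prop
    exact ContinuousWithinAt.comp (f := fun r : ℝ≥0 => min r s) (y.2 (min t s)) h
      fun r hr => min_le_min_right s hr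

variable {κ : E → ℝ≥0}

theorem cumRate_eq (hκ : Measurable κ) (y : RCPath E) (t : ℝ≥0) :
    cumRate κ y t = ∫⁻ s in Iio t, (κ (y.1 s) : ℝ≥0∞) ∂timeMeasure := by
  have hm : Measurable fun s => (κ (y.1 s) : ℝ≥0∞) :=
    (hκ.comp (RCPath.measurable_path y)).coe_nnreal_ennreal
  rw [← lintegral_indicator measurableSet_Iio,
    lintegral_timeMeasure (hm.indicator measurableSet_Iio),
    cumRate, setLIntegral_congr Ico_ae_eq_Icc.symm, ← lintegral_indicator measurableSet_Ico,
    ← lintegral_indicator measurableSet_Ici]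
  congr 1
  ext s
  rcases le_or_gt 0 s with hs | hs
  · lift s to ℝ≥0 using hs
    simp [indicator]
  · rw [indicator_of_notMem (by simp [hs]), indicator_of_notMem (by simpa using hs)]

theorem cumRate_eq_min (hκ : Measurable κ) (y : RCPath E) (t : ℝ≥0) :
    cumRate κ y t = ∫⁻ s, (Iio t).indicator (fun s => (κ (y.1 (min s t)) : ℝ≥0∞)) s
      ∂timeMeasure := by
  rw [cumRate_eq hκ, lintegral_indicator measurableSet_Iio]
  refine setLIntegral_congr_fun measurableSet_Iio fun s hs => ?_
  simp only [min_eq_left (mem_Iio.1 hs).le]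

theorem measurable_cumRate (hκ : Measurable κ) :
    Measurable fun p : RCPath E × ℝ≥0 => cumRate κ p.1 p.2 := by
  have h : ∀ p : RCPath E × ℝ≥0, cumRate κ p.1 p.2 = ∫⁻ s,
      {q : (RCPath E × ℝ≥0) × ℝ≥0 | q.2 < q.1.2}.indicator
        (fun q => (κ (q.1.1.1 q.2) : ℝ≥0∞)) (p, s) ∂timeMeasure := fun p => by
    rw [cumRate_eq hκ, ← lintegral_indicator measurableSet_Iio]
    rfl
  simp_rw [h]
  refine Measurable.lintegral_prod_right' (f := {q : (RCPath E × ℝ≥0) × ℝ≥0 |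
    q.2 < q.1.2}.indicator (fun q => (κ (q.1.1.1 q.2) : ℝ≥0∞))) ?_
  refine Measurable.indicator ?_ (measurableSet_lt measurable_snd measurable_fst.snd)
  exact (hκ.comp (RCPath.measurable_eval.comp
    (measurable_fst.fst.prodMk measurable_snd))).coe_nnreal_ennreal

/-- Makes the survival probability up to `s` an admissible past factor in the Markov property. -/
theorem measurable_past_cumRate (hκ : Measurable κ) (s : ℝ≥0) :
    Measurable[RCPath.past s] fun y : RCPath E => cumRate κ y s := by
  simp_rw [cumRate_eq_min hκ _ s]
  refine @Measurable.lintegral_prod_right' (RCPath E) ℝ≥0 (RCPath.past s) _ timeMeasure _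
    (fun q : RCPath E × ℝ≥0 => (Iio s).indicator (fun r => (κ (q.1.1 (min r s)) : ℝ≥0∞)) q.2) ?_
  have h : Measurable[(RCPath.past s).prod inferInstance]
      fun q : RCPath E × ℝ≥0 => (κ (q.1.1 (min q.2 s)) : ℝ≥0∞) :=
    (hκ.comp (RCPath.measurable_past_eval (E := E) s)).coe_nnreal_ennreal
  have h2 : MeasurableSet[(RCPath.past s).prod inferInstance]
      {q : RCPath E × ℝ≥0 | q.2 < s} :=
    @measurable_snd (RCPath E) ℝ≥0 (RCPath.past s) _ _ (measurableSet_Iio : MeasurableSet (Iio s))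
  exact @Measurable.indicator (RCPath E × ℝ≥0) ℝ≥0∞ {q | q.2 < s} _
    ((RCPath.past s).prod inferInstance) _ _ h h2

theorem cumRate_add (hκ : Measurable κ) (y : RCPath E) (s t : ℝ≥0) :
    cumRate κ y (s + t) = cumRate κ y s + cumRate κ (RCPath.shift s y) t := by
  have hm : Measurable fun s => (κ (y.1 s) : ℝ≥0∞) :=
    (hκ.comp (RCPath.measurable_path y)).coe_nnreal_ennreal
  have h := lintegral_timeMeasure_add s (hm.indicator (measurableSet_Iio (a := s + t)))
  rw [← lintegral_indicator measurableSet_Ici, indicator_indicator,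
    lintegral_indicator (measurableSet_Ici.inter measurableSet_Iio)] at h
  have h2 : cumRate κ (RCPath.shift s y) t = ∫⁻ r in Ici s ∩ Iio (s + t), (κ (y.1 r) : ℝ≥0∞)
      ∂timeMeasure := by
    rw [← h, cumRate_eq hκ, ← lintegral_indicator measurableSet_Iio]
    congr 1
    ext r
    simp [indicator, RCPath.shift]
  rw [h2, cumRate_eq hκ, cumRate_eq hκ, ← lintegral_union (measurableSet_Ici.inter
    measurableSet_Iio)]
  · congr 2
    ext r
    simp only [mem_Iio, mem_union, mem_inter_iff, mem_Ici]
    constructor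
    · intro h
      rcases lt_or_ge r s with h' | h'
      · exact Or.inl h'
      · exact Or.inr ⟨h', h⟩
    · rintro (h | h)
      · exact lt_of_lt_of_le h le_self_add
      · exact h.2
  · exact disjoint_left.2 fun r hr hr' => absurd (mem_Iio.1 hr) (not_lt.2 (mem_Ici.1 hr'.1))

/-- One direction is the definition of the infimum. The other is right-continuity of the accumulated
rate; local boundedness of κ excludes a jump immediately after `t`. -/
theorem lt_hittingTime_iff (hκ : Measurable κ) (hloc : LocallyBounded κ) (y : RCPath E)
    (a : ℝ≥0∞) (t : ℝ≥0) : (t : ℝ≥0∞) < hittingTime κ y a ↔ cumRate κ y t < a := by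
  constructor
  · intro h
    by_contra hn
    exact absurd h (not_lt.2 (hittingTime_le (not_lt.1 hn)))
  · intro h
    obtain ⟨U, hU, C, hC⟩ := hloc (y.1 t)
    -- The path stays in `U` for a short while, so the rate is at most `C` there and the accumulated
    -- rate grows at most linearly.
    have h1 : ∀ᶠ r in 𝓝[≥] t, y.1 r ∈ U := (y.2 t).tendsto.eventually hU
    obtain ⟨b, hb, hbU⟩ := (mem_nhdsGE_iff_exists_Ico_subset' (lt_add_one t)).1 h1
    have h2 : ∀ ε : ℝ≥0, t + ε ≤ b → cumRate κ y (t + ε) ≤ cumRate κ y t + C * ε := by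
      intro ε hε
      rw [cumRate_add hκ, cumRate_eq hκ (RCPath.shift t y)]
      gcongr
      calc ∫⁻ s in Iio ε, (κ ((RCPath.shift t y).1 s) : ℝ≥0∞) ∂timeMeasure
          ≤ ∫⁻ s in Iio ε, (C : ℝ≥0∞) ∂timeMeasure := by
            refine setLIntegral_mono measurable_const fun s hs => ?_
            have : y.1 (t + s) ∈ U := hbU ⟨le_self_add, lt_of_lt_of_le (by simpa using hs) hε⟩
            exact_mod_cast hC (mem_image_of_mem κ this)
        _ = C * ε := by simp [timeMeasure_Iio]
    have h3 : Tendsto (fun ε : ℝ≥0 => cumRate κ y t + C * (ε : ℝ≥0∞)) (𝓝[>] 0)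
        (𝓝 (cumRate κ y t)) := by
      have : Tendsto (fun ε : ℝ≥0 => cumRate κ y t + C * (ε : ℝ≥0∞)) (𝓝 0)
          (𝓝 (cumRate κ y t + ((C * 0 : ℝ≥0) : ℝ≥0∞))) := by
        refine Tendsto.const_add _ ?_
        have hc : Continuous fun ε : ℝ≥0 => ((C * ε : ℝ≥0) : ℝ≥0∞) := by fun_prop
        simpa using hc.tendsto 0
      simpa using this.mono_left nhdsWithin_le_nhds
    have h4 : ∀ᶠ ε : ℝ≥0 in 𝓝[>] 0, t + ε ≤ b := by
      have : Tendsto (fun ε : ℝ≥0 => t + ε) (𝓝[>] 0) (𝓝 (t + 0)) :=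
        ((continuous_const_add t).tendsto 0).mono_left nhdsWithin_le_nhds
      rw [add_zero] at this
      filter_upwards [this.eventually (gt_mem_nhds (mem_Ioi.1 hb))] with ε hε using le_of_lt hε
    obtain ⟨ε, h5, h6, h7⟩ := ((h3.eventually (gt_mem_nhds h)).and
      (h4.and self_mem_nhdsWithin)).exists
    refine lt_of_lt_of_le (b := ((t + ε : ℝ≥0) : ℝ≥0∞)) ?_ ?_
    · exact_mod_cast lt_add_of_pos_right t h7
    · refine le_iInf₂ fun r hr => ?_
      by_contra hn
      have h8 : r ≤ t + ε := by exact_mod_cast le_of_lt (not_le.1 hn)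
      exact absurd (hr.trans ((cumRate_mono κ y h8).trans (h2 ε h6))) (not_le.2 h5)

theorem lt_lifetime_iff (hκ : Measurable κ) (hloc : LocallyBounded κ) (y : RCPath E)
    (ξ : ℝ) (t : ℝ≥0) : (t : ℝ≥0∞) < lifetime κ y ξ ↔ cumRate κ y t < ENNReal.ofReal ξ :=
  lt_hittingTime_iff hκ hloc y _ t

theorem lifetime_pos (hκ : Measurable κ) (hloc : LocallyBounded κ) (y : RCPath E)
    {ξ : ℝ} (hξ : 0 < ξ) : 0 < lifetime κ y ξ := by
  have := (lt_lifetime_iff hκ hloc y ξ 0).2 (by simpa [cumRate_zero] using hξ)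
  simpa using this

theorem measurable_hittingTime (hκ : Measurable κ) (hloc : LocallyBounded κ) :
    Measurable fun p : RCPath E × ℝ≥0∞ => hittingTime κ p.1 p.2 := by
  refine measurable_of_Ioi fun t => ?_
  induction t with
  | top => simp
  | coe t =>
    have : (fun p : RCPath E × ℝ≥0∞ => hittingTime κ p.1 p.2) ⁻¹' Ioi (t : ℝ≥0∞) =
        {p | cumRate κ p.1 t < p.2} := by
      ext p
      exact lt_hittingTime_iff hκ hloc _ _ _
    rw [this]
    exact measurableSet_lt ((measurable_cumRate hκ).comp (measurable_fst.prodMk measurable_const))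
      measurable_snd

theorem measurable_lifetime (hκ : Measurable κ) (hloc : LocallyBounded κ) :
    Measurable fun p : RCPath E × ℝ => lifetime κ p.1 p.2 := by
  have hm : Measurable fun p : RCPath E × ℝ => (p.1, ENNReal.ofReal p.2) := by fun_prop
  have h := (measurable_hittingTime hκ hloc).comp hm
  exact h

theorem eq_of_forall_coe_lt_iff {a b : ℝ≥0∞} (h : ∀ t : ℝ≥0, (t : ℝ≥0∞) < a ↔ t < b) : a = b :=
  le_antisymm (ENNReal.le_of_forall_nnreal_lt fun t ht => ((h t).1 ht).le)
    (ENNReal.le_of_forall_nnreal_lt fun t ht => ((h t).2 ht).le)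

/-- The shifted path still has to accumulate what is left of the level `a`. Comparing both sides
with every finite time also covers infinite values. -/
theorem hittingTime_eq_add (hκ : Measurable κ) (hloc : LocallyBounded κ) (y : RCPath E)
    {a : ℝ≥0∞} {s : ℝ≥0} (h : cumRate κ y s < a) :
    hittingTime κ y a = s + hittingTime κ (RCPath.shift s y) (a - cumRate κ y s) := by
  refine eq_of_forall_coe_lt_iff fun t => ?_
  rw [lt_hittingTime_iff hκ hloc]
  rcases lt_or_ge t s with hts | hts
  · exact iff_of_true (lt_of_le_of_lt (cumRate_mono κ y hts.le) h)
      (lt_of_lt_of_le (by exact_mod_cast hts) le_self_add)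
  · obtain ⟨r, rfl⟩ := exists_add_of_le hts
    rw [cumRate_add hκ, ENNReal.coe_add, ENNReal.add_lt_add_iff_left ENNReal.coe_ne_top,
      lt_hittingTime_iff hκ hloc, lt_tsub_iff_left]

/-- The conditional law of the lifetime given survival up to time `s`. -/
theorem lintegral_lifetime_tail (hκ : Measurable κ) (hloc : LocallyBounded κ) (y : RCPath E)
    (s : ℝ≥0) {f : ℝ≥0∞ → ℝ≥0∞} (hf : Measurable f) :
    ∫⁻ ξ in {ξ | (s : ℝ≥0∞) < lifetime κ y ξ}, f (lifetime κ y ξ) ∂(expMeasure 1) =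
      expTail (cumRate κ y s) *
        ∫⁻ ξ, f (s + lifetime κ (RCPath.shift s y) ξ) ∂(expMeasure 1) := by
  have hm : Measurable fun a => f (s + hittingTime κ (RCPath.shift s y) a) :=
    hf.comp (((measurable_hittingTime hκ hloc).comp measurable_prodMk_left).const_add _)
  have h := lintegral_expMeasure_tail (cumRate κ y s) hm
  change _ = _ * ∫⁻ ξ, f (s + hittingTime κ (RCPath.shift s y) (ENNReal.ofReal ξ)) ∂(expMeasure 1)
  rw [← h]
  have hs : {ξ : ℝ | (s : ℝ≥0∞) < lifetime κ y ξ} = {ξ | cumRate κ y s < ENNReal.ofReal ξ} := by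
    ext ξ
    exact lt_lifetime_iff hκ hloc y ξ s
  rw [hs]
  refine setLIntegral_congr_fun (measurableSet_lt_ofReal _) fun ξ hξ => ?_
  exact congrArg f (hittingTime_eq_add hκ hloc y hξ)

theorem expMeasure_lt_lifetime (hκ : Measurable κ) (hloc : LocallyBounded κ) (y : RCPath E)
    (s : ℝ≥0) : expMeasure 1 {ξ | (s : ℝ≥0∞) < lifetime κ y ξ} = expTail (cumRate κ y s) := by
  congr 1
  ext ξ
  exact lt_lifetime_iff hκ hloc y ξ s

end Paths

/-! ### Pathwise structure of the Restore process -/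

/-- Prepend `p` to the sequence `z`. -/
def consSeq {α : Type*} (p : α) (z : ℕ → α) : ℕ → α
  | 0 => p
  | n + 1 => z n

theorem measurable_consSeq {α : Type*} [MeasurableSpace α] :
    Measurable fun q : α × (ℕ → α) => consSeq q.1 q.2 := by
  refine measurable_pi_lambda _ fun n => ?_
  cases n with
  | zero => exact measurable_fst
  | succ n => exact (measurable_pi_apply n).comp measurable_snd

section Pathwise

variable {E : Type*} [TopologicalSpace E] {κ : E → ℝ≥0}

theorem exists_tour {z : ℕ → RCPath E × ℝ} {t : ℝ≥0}
    (h : ∃ n, (t : ℝ≥0∞) < regenTime κ z n) :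
    ∃ i, regenTime κ z i ≤ t ∧ (t : ℝ≥0∞) < regenTime κ z (i + 1) := by
  classical
  have h0 : Nat.find h ≠ 0 := fun h0 => by
    have := Nat.find_spec h
    rw [h0] at this
    simp [regenTime] at this
  obtain ⟨i, hi⟩ := Nat.exists_eq_succ_of_ne_zero h0
  refine ⟨i, not_lt.1 (Nat.find_min h (by omega)), ?_⟩
  have := Nat.find_spec h
  rwa [hi] at this

theorem regenTime_consSeq (p : RCPath E × ℝ) (z : ℕ → RCPath E × ℝ) (n : ℕ) :
    regenTime κ (consSeq p z) (n + 1) = lifetime κ p.1 p.2 + regenTime κ z n := by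
  rw [regenTime, Finset.sum_range_succ', add_comm]
  rfl

theorem restorePath_consSeq_of_lt {p : RCPath E × ℝ} (z : ℕ → RCPath E × ℝ) {t : ℝ≥0}
    (h : (t : ℝ≥0∞) < lifetime κ p.1 p.2) : restorePath κ (consSeq p z) t = p.1.1 t := by
  rw [restorePath_eq κ _ t 0 (by simp [regenTime])
    (by rw [regenTime_consSeq]; exact h.trans_le le_self_add)]
  simp [regenTime, consSeq]

/-- All regeneration times of the tail are delayed by the first lifetime. Non-explosion of `z` is
needed because the default index 0 would point to different tours in the two sequences. -/
theorem restorePath_consSeq_of_le {p : RCPath E × ℝ} {z : ℕ → RCPath E × ℝ} {t : ℝ≥0}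
    (h : lifetime κ p.1 p.2 ≤ t) (hz : ∀ t : ℝ≥0, ∃ n, (t : ℝ≥0∞) < regenTime κ z n) :
    restorePath κ (consSeq p z) t =
      restorePath κ z ((t : ℝ≥0∞) - lifetime κ p.1 p.2).toNNReal := by
  have hr : (((t : ℝ≥0∞) - lifetime κ p.1 p.2).toNNReal : ℝ≥0∞) = t - lifetime κ p.1 p.2 :=
    ENNReal.coe_toNNReal (ne_top_of_le_ne_top ENNReal.coe_ne_top tsub_le_self)
  obtain ⟨i, h1, h2⟩ := exists_tour (hz ((t : ℝ≥0∞) - lifetime κ p.1 p.2).toNNReal)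
  rw [restorePath_eq κ z _ i h1 h2]
  rw [hr] at h1 h2 ⊢
  have hfin : lifetime κ p.1 p.2 ≠ ∞ := ne_top_of_le_ne_top ENNReal.coe_ne_top h
  rw [restorePath_eq κ _ t (i + 1), regenTime_consSeq, tsub_add_eq_tsub_tsub]
  · rfl
  · rw [regenTime_consSeq, ← add_tsub_cancel_of_le h]
    gcongr
  · rw [regenTime_consSeq, ← add_tsub_cancel_of_le h]
    exact (ENNReal.add_lt_add_iff_left hfin).2 h2

theorem continuousWithinAt_restorePath {z : ℕ → RCPath E × ℝ}
    (hz : ∀ t : ℝ≥0, ∃ n, (t : ℝ≥0∞) < regenTime κ z n) (t : ℝ≥0) :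
    ContinuousWithinAt (fun s => restorePath κ z s) (Ici t) t := by
  obtain ⟨i, h1, h2⟩ := exists_tour (hz t)
  obtain ⟨c, hc⟩ : ∃ c : ℝ≥0, regenTime κ z i = c :=
    ⟨_, (ENNReal.coe_toNNReal (ne_top_of_le_ne_top ENNReal.coe_ne_top h1)).symm⟩
  have hct : c ≤ t := by rw [hc] at h1; exact_mod_cast h1
  have key : ∀ s, t ≤ s → (s : ℝ≥0∞) < regenTime κ z (i + 1) →
      restorePath κ z s = (z i).1.1 (s - c) := fun s hs hs2 => by
    rw [restorePath_eq κ z s i (h1.trans (by exact_mod_cast hs)) hs2, hc, ← ENNReal.coe_sub,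
      ENNReal.toNNReal_coe]
  have hcont : ContinuousWithinAt (fun s : ℝ≥0 => (z i).1.1 (s - c)) (Ici t) t := by
    have h : ContinuousWithinAt (fun r : ℝ≥0 => r - c) (Ici t) t := by fun_prop
    exact ContinuousWithinAt.comp (f := fun r : ℝ≥0 => r - c) ((z i).1.2 (t - c)) h
      fun r hr => tsub_le_tsub_right hr c
  refine hcont.congr_of_eventuallyEq ?_ (key t le_rfl h2)
  have hev : ∀ᶠ s : ℝ≥0 in 𝓝 t, (s : ℝ≥0∞) < regenTime κ z (i + 1) :=
    (ENNReal.continuous_coe.tendsto t).eventually (gt_mem_nhds h2)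
  filter_upwards [self_mem_nhdsWithin, nhdsWithin_le_nhds hev] with s hs hs2 using key s hs hs2

variable [MeasurableSpace E] [BorelSpace E] [TopologicalSpace.PseudoMetrizableSpace E]

theorem measurable_regenTime (hκ : Measurable κ) (hloc : LocallyBounded κ) (n : ℕ) :
    Measurable fun z : ℕ → RCPath E × ℝ => regenTime κ z n := by
  unfold regenTime
  refine Finset.measurable_fun_sum _ fun i _ => ?_
  have h := (measurable_lifetime hκ hloc).comp
    (measurable_pi_apply (X := fun _ : ℕ => RCPath E × ℝ) i)
  exact h

theorem measurable_tourIndex (hκ : Measurable κ) (hloc : LocallyBounded κ) :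
    Measurable fun q : (ℕ → RCPath E × ℝ) × ℝ≥0 => tourIndex κ q.1 q.2 := by
  have hm : ∀ n, MeasurableSet {q : (ℕ → RCPath E × ℝ) × ℝ≥0 | (q.2 : ℝ≥0∞) <
      regenTime κ q.1 (n + 1)} := fun n =>
    measurableSet_lt (by fun_prop) ((measurable_regenTime hκ hloc (n + 1)).comp measurable_fst)
  refine measurable_to_countable' fun n => ?_
  -- The second set is the default case: if no regeneration time exceeds t, the index is the infimum
  -- of the empty set, which is 0.
  have : (fun q : (ℕ → RCPath E × ℝ) × ℝ≥0 => tourIndex κ q.1 q.2) ⁻¹' {n} =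
      ({q | (q.2 : ℝ≥0∞) < regenTime κ q.1 (n + 1)} ∩
        ⋂ m ∈ Iio n, {q | (q.2 : ℝ≥0∞) < regenTime κ q.1 (m + 1)}ᶜ) ∪
      ({_q | n = 0} ∩ ⋂ m, {q | (q.2 : ℝ≥0∞) < regenTime κ q.1 (m + 1)}ᶜ) := by
    ext q
    simp only [mem_preimage, mem_singleton_iff, mem_union, mem_inter_iff, mem_iInter, mem_compl_iff,
      mem_ofPred_eq, mem_Iio]
    constructor
    · rintro rfl
      rcases Set.eq_empty_or_nonempty {i : ℕ | (q.2 : ℝ≥0∞) < regenTime κ q.1 (i + 1)} with h | h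
      · refine Or.inr ⟨by rw [tourIndex, h, Nat.sInf_empty], fun m hm => ?_⟩
        have : m ∈ {i : ℕ | (q.2 : ℝ≥0∞) < regenTime κ q.1 (i + 1)} := hm
        rw [h] at this
        exact this
      · exact Or.inl ⟨Nat.sInf_mem h, fun m hm => Nat.notMem_of_lt_sInf hm⟩
    · rintro (⟨h1, h2⟩ | ⟨rfl, h⟩)
      · refine le_antisymm (Nat.sInf_le h1) (le_csInf ⟨n, h1⟩ fun m hm => ?_)
        by_contra hn
        exact h2 m (not_le.1 hn) hm
      · have h0 : {i : ℕ | (q.2 : ℝ≥0∞) < regenTime κ q.1 (i + 1)} = ∅ :=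
          Set.eq_empty_of_forall_notMem fun m hm => h m hm
        rw [tourIndex, h0, Nat.sInf_empty]
  rw [this]
  refine ((hm n).inter ?_).union ((MeasurableSet.const _).inter (MeasurableSet.iInter fun m =>
    (hm m).compl))
  exact MeasurableSet.biInter (to_countable _) fun m _ => (hm m).compl

theorem measurable_restorePath (hκ : Measurable κ) (hloc : LocallyBounded κ) :
    Measurable fun q : (ℕ → RCPath E × ℝ) × ℝ≥0 => restorePath κ q.1 q.2 := by
  have h1 : Measurable fun p : ((ℕ → RCPath E × ℝ) × ℝ≥0) × ℕ =>
      (p.1.1 p.2).1.1 ((p.1.2 : ℝ≥0∞) - regenTime κ p.1.1 p.2).toNNReal := by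
    refine measurable_from_prod_countable_left fun i => ?_
    have h2 : Measurable fun q : (ℕ → RCPath E × ℝ) × ℝ≥0 =>
        ((q.1 i).1, ((q.2 : ℝ≥0∞) - regenTime κ q.1 i).toNNReal) := by
      refine Measurable.prodMk (by fun_prop) ?_
      have : Measurable fun q : (ℕ → RCPath E × ℝ) × ℝ≥0 => regenTime κ q.1 i :=
        (measurable_regenTime hκ hloc i).comp measurable_fst
      exact ((measurable_snd.coe_nnreal_ennreal).sub this).ennreal_toNNReal
    have h3 := RCPath.measurable_eval.comp h2
    exact h3
  have h4 := h1.comp (measurable_id.prodMk (measurable_tourIndex hκ hloc))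
  exact h4

end Pathwise

/-! ### The law of the driving sequence and the decomposition at the first regeneration -/

theorem infinitePi_nat_eq_map_consSeq {α : Type*} [MeasurableSpace α] (P : ℕ → Measure α)
    [∀ i, IsProbabilityMeasure (P i)] :
    Measure.infinitePi P = ((P 0).prod (Measure.infinitePi fun i => P (i + 1))).map
      fun q => consSeq q.1 q.2 := by
  classical
  symm
  refine Measure.eq_infinitePi _ fun s t ht => ?_
  -- Padding the finite index set to an initial segment with full factors separates coordinate 0
  -- from the shifted ones.
  obtain ⟨N, hN⟩ : ∃ N, s ⊆ Finset.range (N + 1) :=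
    ⟨s.sup id, fun i hi => Finset.mem_range.2 (Nat.lt_succ_of_le (Finset.le_sup (f := id) hi))⟩
  set t' : ℕ → Set α := fun i => if i ∈ s then t i else univ with ht'
  have ht'm : ∀ i, MeasurableSet (t' i) := fun i => by
    simp only [ht']
    split_ifs
    exacts [ht i, MeasurableSet.univ]
  have h1 : (s : Set ℕ).pi t = (Finset.range (N + 1) : Set ℕ).pi t' := by
    ext z
    simp only [Set.mem_pi, SetLike.mem_coe]
    constructor
    · intro h i _
      by_cases hi : i ∈ s
      · simpa [ht', hi] using h i hi
      · simp [ht', hi]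
    · intro h i hi
      simpa [ht', hi] using h i (hN hi)
  have h2 : ∏ i ∈ s, P i (t i) = ∏ i ∈ Finset.range (N + 1), P i (t' i) := by
    rw [← Finset.prod_subset hN]
    · exact Finset.prod_congr rfl fun i hi => by simp [ht', hi]
    · intro i _ hi
      simp [ht', hi]
  have h3 : (fun q : α × (ℕ → α) => consSeq q.1 q.2) ⁻¹' ((Finset.range (N + 1) : Set ℕ).pi t') =
      t' 0 ×ˢ (Finset.range N : Set ℕ).pi fun i => t' (i + 1) := by
    ext q
    simp only [mem_preimage, Set.mem_pi, SetLike.mem_coe, Finset.mem_range, mem_prod]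
    constructor
    · intro h
      exact ⟨h 0 (by omega), fun i hi => h (i + 1) (by omega)⟩
    · rintro ⟨h0, h⟩ i hi
      cases i with
      | zero => exact h0
      | succ i => exact h i (by omega)
  rw [h1, h2, Measure.map_apply measurable_consSeq
    (MeasurableSet.pi (Finset.countable_toSet _) fun i _ => ht'm i), h3, Measure.prod_prod,
    Measure.infinitePi_pi _ fun i _ => ht'm (i + 1), Finset.prod_range_succ', mul_comm]

section Laws

attribute [local irreducible] lifetime cumRate restorePath

variable {E : Type*} [TopologicalSpace E] [MeasurableSpace E]

instance (Q : Measure (RCPath E)) [IsProbabilityMeasure Q] :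
    IsProbabilityMeasure (clockedLaw Q) := by
  unfold clockedLaw
  infer_instance

/-- The law of a sequence of independent copies of a clocked path of law `Q`. -/
noncomputable def iidLaw (Q : Measure (RCPath E)) : Measure (ℕ → RCPath E × ℝ) :=
  Measure.infinitePi fun _ => clockedLaw Q

instance (Q : Measure (RCPath E)) [IsProbabilityMeasure Q] : IsProbabilityMeasure (iidLaw Q) := by
  unfold iidLaw
  infer_instance

theorem driverLaw_eq (Y : RightProcess E) (ν : Measure E) [IsProbabilityMeasure ν] (x : E) :
    driverLaw Y ν x = ((clockedLaw (Y.law x)).prod (iidLaw (Y.lawFrom ν))).map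
      fun q => consSeq q.1 q.2 := by
  have h0 := Y.prob x
  have h1 := Y.isProbabilityMeasure_lawFrom ν
  have : ∀ i : ℕ, IsProbabilityMeasure
      (clockedLaw (if i = 0 then Y.law x else Y.lawFrom ν)) := fun i => by
    split_ifs <;> infer_instance
  rw [driverLaw, infinitePi_nat_eq_map_consSeq]
  simp [iidLaw]

theorem iidLaw_eq (Q : Measure (RCPath E)) [IsProbabilityMeasure Q] :
    iidLaw Q = ((clockedLaw Q).prod (iidLaw Q)).map fun q => consSeq q.1 q.2 :=
  infinitePi_nat_eq_map_consSeq _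

theorem lintegral_map_consSeq (P Q : Measure (RCPath E)) [IsProbabilityMeasure P]
    [IsProbabilityMeasure Q] {F : (ℕ → RCPath E × ℝ) → ℝ≥0∞} (hF : Measurable F) :
    ∫⁻ z, F z ∂(((clockedLaw P).prod (iidLaw Q)).map fun q => consSeq q.1 q.2) =
      ∫⁻ y, ∫⁻ ξ, ∫⁻ z, F (consSeq (y, ξ) z) ∂(iidLaw Q) ∂(expMeasure 1) ∂P := by
  have hF' : Measurable fun q : (RCPath E × ℝ) × (ℕ → RCPath E × ℝ) => F (consSeq q.1 q.2) :=
    hF.comp measurable_consSeq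
  rw [lintegral_map hF measurable_consSeq, lintegral_prod _ hF'.aemeasurable, clockedLaw,
    lintegral_prod _ (hF'.lintegral_prod_right').aemeasurable]

variable [BorelSpace E] [TopologicalSpace.PseudoMetrizableSpace E] {κ : E → ℝ≥0}

theorem expTail_lt_one {a : ℝ≥0∞} (ha : 0 < a) : expTail a < 1 := by
  induction a with
  | top => simp [expTail_top]
  | coe a =>
    rw [expTail_coe, ENNReal.ofReal_lt_one, Real.exp_lt_one_iff]
    simpa using ha

theorem measurable_lifetime_right (hκ : Measurable κ) (hloc : LocallyBounded κ) (y : RCPath E) :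
    Measurable (lifetime κ y) := by
  have h := (measurable_lifetime hκ hloc).comp (measurable_prodMk_left (x := y))
  exact h

/-- Lifetimes are almost surely positive because the clock is, and strict inequality survives
integration against probability measures. This supplies the contraction factor both for
non-explosion and for the law at the exponential time. -/
theorem lintegral_lifetime_lt_one (hκ : Measurable κ) (hloc : LocallyBounded κ)
    (Q : Measure (RCPath E)) [IsProbabilityMeasure Q] {g : ℝ≥0∞ → ℝ≥0∞}
    (hg : ∀ a, 0 < a → g a < 1) :
    ∫⁻ y, ∫⁻ ξ, g (lifetime κ y ξ) ∂(expMeasure 1) ∂Q < 1 := by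
  have h0 : ∀ y : RCPath E, ∀ᵐ ξ ∂(expMeasure 1), g (lifetime κ y ξ) < 1 := fun y => by
    filter_upwards [ae_expMeasure_pos] with ξ hξ
    exact hg _ (lifetime_pos hκ hloc y hξ)
  have h1 : ∀ y : RCPath E, ∫⁻ ξ, g (lifetime κ y ξ) ∂(expMeasure 1) < 1 := fun y => by
    calc ∫⁻ ξ, g (lifetime κ y ξ) ∂(expMeasure 1) < ∫⁻ ξ : ℝ, 1 ∂(expMeasure 1) := by
          refine lintegral_strict_mono (IsProbabilityMeasure.ne_zero _) aemeasurable_const ?_ (h0 y)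
          refine ne_top_of_le_ne_top ENNReal.one_ne_top ?_
          exact (lintegral_mono_ae ((h0 y).mono fun ξ h => h.le)).trans (by simp)
      _ = 1 := by simp
  calc ∫⁻ y, ∫⁻ ξ, g (lifetime κ y ξ) ∂(expMeasure 1) ∂Q < ∫⁻ _ : RCPath E, 1 ∂Q := by
        refine lintegral_strict_mono (IsProbabilityMeasure.ne_zero _) aemeasurable_const ?_
          (Eventually.of_forall h1)
        refine ne_top_of_le_ne_top ENNReal.one_ne_top ?_
        exact (lintegral_mono fun y => (h1 y).le).trans (by simp)
    _ = 1 := by simp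

/-- The lifetimes are i.i.d. and `expTail` turns sums into products. -/
theorem lintegral_expTail_regenTime (hκ : Measurable κ) (hloc : LocallyBounded κ)
    (Q : Measure (RCPath E)) [IsProbabilityMeasure Q] (n : ℕ) :
    ∫⁻ z, expTail (regenTime κ z n) ∂(iidLaw Q) =
      (∫⁻ y, ∫⁻ ξ, expTail (lifetime κ y ξ) ∂(expMeasure 1) ∂Q) ^ n := by
  have hm : ∀ n, Measurable fun z : ℕ → RCPath E × ℝ => expTail (regenTime κ z n) := fun n =>
    measurable_expTail.comp (measurable_regenTime hκ hloc n)
  have hl : Measurable fun p : RCPath E × ℝ => expTail (lifetime κ p.1 p.2) :=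
    measurable_expTail.comp (measurable_lifetime hκ hloc)
  induction n with
  | zero => simp [regenTime, show expTail 0 = 1 by simpa using expTail_coe 0]
  | succ n ih =>
    rw [iidLaw_eq, lintegral_map_consSeq Q Q (hm (n + 1)), pow_succ, ← ih]
    simp_rw [regenTime_consSeq, expTail_add]
    simp_rw [lintegral_const_mul _ (hm n)]
    have hl2 : Measurable fun y => ∫⁻ ξ, expTail (lifetime κ y ξ) ∂(expMeasure 1) :=
      Measurable.lintegral_prod_right'
        (f := fun p : RCPath E × ℝ => expTail (lifetime κ p.1 p.2)) hl
    rw [mul_comm, ← lintegral_mul_const _ hl2]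
    refine lintegral_congr fun y => ?_
    exact lintegral_mul_const _ (measurable_expTail.comp (measurable_lifetime_right hκ hloc y))

/-- Almost surely, the regeneration times tend to infinity. -/
theorem ae_iidLaw_exists_lt_regenTime (hκ : Measurable κ) (hloc : LocallyBounded κ)
    (Q : Measure (RCPath E)) [IsProbabilityMeasure Q] :
    ∀ᵐ z ∂(iidLaw Q), ∀ t : ℝ≥0, ∃ n, (t : ℝ≥0∞) < regenTime κ z n := by
  have h : ∀ k : ℕ, ∀ᵐ z ∂(iidLaw Q), ∃ n, ((k : ℝ≥0) : ℝ≥0∞) < regenTime κ z n := by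
    intro k
    have h0 : 0 < expTail (k : ℝ≥0) := expTail_pos ENNReal.coe_ne_top
    -- Markov's inequality: on the event that no regeneration time exceeds `k`, each `expTail
    -- (regenTime κ z n)` is at least `expTail k`, while its mean decays geometrically in `n`.
    have hle : ∀ n, expTail (k : ℝ≥0) *
        iidLaw Q {z | ¬ ∃ n, ((k : ℝ≥0) : ℝ≥0∞) < regenTime κ z n} ≤
        (∫⁻ y, ∫⁻ ξ, expTail (lifetime κ y ξ) ∂(expMeasure 1) ∂Q) ^ n := fun n => by
      rw [← lintegral_expTail_regenTime hκ hloc]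
      refine le_trans ?_ (mul_meas_ge_le_lintegral₀ (μ := iidLaw Q)
        (measurable_expTail.comp (measurable_regenTime hκ hloc n)).aemeasurable
        (expTail (k : ℝ≥0)))
      gcongr
      rename_i z
      intro hz
      exact expTail_antitone (not_lt.1 fun h => hz ⟨n, h⟩)
    have hlim := ENNReal.tendsto_pow_atTop_nhds_zero_of_lt_one
      (lintegral_lifetime_lt_one hκ hloc Q fun _ => expTail_lt_one)
    exact (mul_eq_zero.1 (le_antisymm (ge_of_tendsto' hlim hle) zero_le)).resolve_left h0.ne'
  filter_upwards [ae_all_iff.2 h] with z hz t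
  obtain ⟨k, hk⟩ := exists_nat_ge t
  obtain ⟨n, hn⟩ := hz k
  exact ⟨n, lt_of_le_of_lt (by exact_mod_cast hk) hn⟩

/-- `u (t - σ)`, for a delay `σ ≤ t`, and `0` otherwise. -/
noncomputable def delayed (u : ℝ≥0 → ℝ≥0∞) (t : ℝ≥0) (σ : ℝ≥0∞) : ℝ≥0∞ :=
  if σ ≤ t then u ((t : ℝ≥0∞) - σ).toNNReal else 0

theorem measurable_delayed {u : ℝ≥0 → ℝ≥0∞} (hu : Measurable u) :
    Measurable fun p : ℝ≥0 × ℝ≥0∞ => delayed u p.1 p.2 := by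
  unfold delayed
  refine Measurable.ite (measurableSet_le measurable_snd (by fun_prop)) ?_ measurable_const
  exact hu.comp (by fun_prop)

/-- The contribution of a path `y` of the first tour, when `u` is the expectation after the first
regeneration. -/
noncomputable def firstTour (κ : E → ℝ≥0) (f : E → ℝ≥0∞) (u : ℝ≥0 → ℝ≥0∞) (t : ℝ≥0)
    (y : RCPath E) : ℝ≥0∞ :=
  expTail (cumRate κ y t) * f (y.1 t) + ∫⁻ ξ, delayed u t (lifetime κ y ξ) ∂(expMeasure 1)

theorem measurable_delayed_lifetime (hκ : Measurable κ) (hloc : LocallyBounded κ)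
    {u : ℝ≥0 → ℝ≥0∞} (hu : Measurable u) :
    Measurable fun p : (RCPath E × ℝ≥0) × ℝ => delayed u p.1.2 (lifetime κ p.1.1 p.2) := by
  have hm : Measurable fun p : (RCPath E × ℝ≥0) × ℝ => (p.1.1, p.2) := by fun_prop
  have h := (measurable_lifetime hκ hloc).comp hm
  have h2 := (measurable_delayed hu).comp (measurable_fst.snd.prodMk h)
  exact h2

theorem measurable_expTail_mul (hκ : Measurable κ) {f : E → ℝ≥0∞} (hf : Measurable f) :
    Measurable fun p : RCPath E × ℝ≥0 => expTail (cumRate κ p.1 p.2) * f (p.1.1 p.2) :=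
  (measurable_expTail.comp (measurable_cumRate hκ)).mul (hf.comp RCPath.measurable_eval)

theorem measurable_firstTour (hκ : Measurable κ) (hloc : LocallyBounded κ) {f : E → ℝ≥0∞}
    (hf : Measurable f) {u : ℝ≥0 → ℝ≥0∞} (hu : Measurable u) :
    Measurable fun p : RCPath E × ℝ≥0 => firstTour κ f u p.2 p.1 := by
  have h := (measurable_delayed_lifetime hκ hloc hu).lintegral_prod_right' (ν := expMeasure 1)
  exact (measurable_expTail_mul hκ hf).add h

/-- The expectation of `f (X_t)` for the Restore process with all tours of law `Q`. -/
noncomputable def restoreMean (κ : E → ℝ≥0) (Q : Measure (RCPath E)) (f : E → ℝ≥0∞) (t : ℝ≥0) :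
    ℝ≥0∞ :=
  ∫⁻ z, f (restorePath κ z t) ∂(iidLaw Q)

theorem measurable_restoreMean (hκ : Measurable κ) (hloc : LocallyBounded κ)
    (Q : Measure (RCPath E)) [IsProbabilityMeasure Q] {f : E → ℝ≥0∞} (hf : Measurable f) :
    Measurable (restoreMean κ Q f) := by
  have h : Measurable fun q : (ℕ → RCPath E × ℝ) × ℝ≥0 => f (restorePath κ q.1 q.2) :=
    hf.comp (measurable_restorePath hκ hloc)
  exact h.lintegral_prod_left'

theorem measurable_restorePath_apply (hκ : Measurable κ) (hloc : LocallyBounded κ) (t : ℝ≥0) :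
    Measurable fun z : ℕ → RCPath E × ℝ => restorePath κ z t :=
  (measurable_restorePath hκ hloc).comp measurable_prodMk_right

/-- Decomposition at the first regeneration. -/
theorem lintegral_restorePath_eq (hκ : Measurable κ) (hloc : LocallyBounded κ)
    (P Q : Measure (RCPath E)) [IsProbabilityMeasure P] [IsProbabilityMeasure Q]
    {f : E → ℝ≥0∞} (hf : Measurable f) (t : ℝ≥0) :
    ∫⁻ z, f (restorePath κ z t)
        ∂(((clockedLaw P).prod (iidLaw Q)).map fun q => consSeq q.1 q.2) =
      ∫⁻ y, firstTour κ f (restoreMean κ Q f) t y ∂P := by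
  rw [lintegral_map_consSeq P Q (F := fun z => f (restorePath κ z t))
    (hf.comp (measurable_restorePath_apply hκ hloc t))]
  refine lintegral_congr fun y => ?_
  -- Either the first tour is still running at time `t`, or the remaining i.i.d. sequence has been
  -- running a fresh process since the first regeneration.
  have h : ∀ ξ, ∫⁻ z, f (restorePath κ (consSeq (y, ξ) z) t) ∂(iidLaw Q) =
      {ξ | (t : ℝ≥0∞) < lifetime κ y ξ}.indicator (fun _ => f (y.1 t)) ξ +
        delayed (restoreMean κ Q f) t (lifetime κ y ξ) := fun ξ => by
    rcases lt_or_ge (t : ℝ≥0∞) (lifetime κ y ξ) with hlt | hle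
    · simp_rw [restorePath_consSeq_of_lt (p := (y, ξ)) _ hlt]
      rw [indicator_of_mem (by exact hlt), delayed, if_neg (not_le.2 hlt)]
      simp
    · rw [indicator_of_notMem (by simpa using hle), delayed, if_pos hle, zero_add, restoreMean]
      refine lintegral_congr_ae ?_
      filter_upwards [ae_iidLaw_exists_lt_regenTime hκ hloc Q] with z hz
      rw [restorePath_consSeq_of_le hle hz]
  have hset : MeasurableSet {ξ | (t : ℝ≥0∞) < lifetime κ y ξ} :=
    measurableSet_lt measurable_const (measurable_lifetime_right hκ hloc y)
  simp_rw [h]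
  rw [lintegral_add_left (measurable_const.indicator hset), lintegral_indicator hset,
    setLIntegral_const, expMeasure_lt_lifetime hκ hloc, mul_comm]
  rfl

/-- The renewal equation. -/
theorem restoreMean_eq (hκ : Measurable κ) (hloc : LocallyBounded κ)
    (Q : Measure (RCPath E)) [IsProbabilityMeasure Q] {f : E → ℝ≥0∞} (hf : Measurable f)
    (t : ℝ≥0) :
    restoreMean κ Q f t = ∫⁻ y, firstTour κ f (restoreMean κ Q f) t y ∂Q := by
  rw [← lintegral_restorePath_eq hκ hloc Q Q hf, ← iidLaw_eq]
  rfl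

theorem lintegral_restoreTransition (hκ : Measurable κ) (hloc : LocallyBounded κ)
    (Y : RightProcess E) (ν : Measure E) [IsProbabilityMeasure ν] {f : E → ℝ≥0∞}
    (hf : Measurable f) (t : ℝ≥0) (x : E) :
    ∫⁻ a, f a ∂(restoreTransition Y κ ν t x) =
      ∫⁻ y, firstTour κ f (restoreMean κ (Y.lawFrom ν) f) t y ∂(Y.law x) := by
  have h0 := Y.prob x
  have h1 := Y.isProbabilityMeasure_lawFrom ν
  rw [restoreTransition, lintegral_map hf (measurable_restorePath_apply hκ hloc t), driverLaw_eq,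
    lintegral_restorePath_eq hκ hloc _ _ hf]

end Laws

/-! ### The Markov property for functionals -/

section Markov

variable {E : Type*} [TopologicalSpace E] [MeasurableSpace E]

/-- Path laws are only universally measurable in the starting point; the finite measure to test
against is the law of the position at time `s`. -/
theorem RightProcess.aemeasurable_law_apply (Y : RightProcess E) (Q : Measure (RCPath E))
    [IsFiniteMeasure Q] (s : ℝ≥0) : AEMeasurable (fun y : RCPath E => Y.law (y.1 s)) Q :=
  (Y.meas (Q.map fun y : RCPath E => y.1 s) inferInstance).comp_measurable
    (RCPath.measurable_apply s)

theorem RightProcess.lawFrom_inter_shift (Y : RightProcess E) (ν : Measure E)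
    [IsProbabilityMeasure ν] (s : ℝ≥0) {A B : Set (RCPath E)}
    (hA : MeasurableSet[RCPath.past s] A) (hB : MeasurableSet B) :
    Y.lawFrom ν (A ∩ RCPath.shift s ⁻¹' B) = ∫⁻ y in A, Y.law (y.1 s) B ∂(Y.lawFrom ν) := by
  have hQ := Y.isProbabilityMeasure_lawFrom ν
  have hν := Y.meas ν inferInstance
  have hA' : MeasurableSet A := RCPath.past_le s A hA
  have hB' : AEMeasurable (fun y : RCPath E => Y.law (y.1 s) B) (Y.lawFrom ν) :=
    (Measure.measurable_coe hB).comp_aemeasurable (Y.aemeasurable_law_apply _ s)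
  rw [← lintegral_indicator hA', RightProcess.lawFrom,
    Measure.lintegral_bind hν (hB'.indicator hA'),
    Measure.bind_apply (hA'.inter (RCPath.measurable_shift s hB)) hν]
  refine lintegral_congr fun x => ?_
  rw [Y.markov x s A B hA hB, lintegral_indicator hA']

theorem RightProcess.setLIntegral_shift (Y : RightProcess E) (ν : Measure E)
    [IsProbabilityMeasure ν] (s : ℝ≥0) {A : Set (RCPath E)}
    (hA : MeasurableSet[RCPath.past s] A) {H : RCPath E → ℝ≥0∞} (hH : Measurable H) :
    ∫⁻ y in A, H (RCPath.shift s y) ∂(Y.lawFrom ν) =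
      ∫⁻ y in A, ∫⁻ w, H w ∂(Y.law (y.1 s)) ∂(Y.lawFrom ν) := by
  have hQ := Y.isProbabilityMeasure_lawFrom ν
  have hA' : MeasurableSet A := RCPath.past_le s A hA
  have hl := Y.aemeasurable_law_apply ((Y.lawFrom ν).restrict A) s
  have h : ((Y.lawFrom ν).restrict A).map (RCPath.shift s) =
      ((Y.lawFrom ν).restrict A).bind fun y => Y.law (y.1 s) := by
    ext B hB
    rw [Measure.map_apply (RCPath.measurable_shift s) hB, Measure.bind_apply hB hl,
      Measure.restrict_apply (RCPath.measurable_shift s hB), inter_comm,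
      Y.lawFrom_inter_shift ν s hA hB]
  rw [← lintegral_map hH (RCPath.measurable_shift s), h,
    Measure.lintegral_bind hl hH.aemeasurable]

theorem RightProcess.lintegral_mul_shift (Y : RightProcess E) (ν : Measure E)
    [IsProbabilityMeasure ν] (s : ℝ≥0) {G : RCPath E → ℝ≥0∞}
    (hG : Measurable[RCPath.past s] G) {H : RCPath E → ℝ≥0∞} (hH : Measurable H) :
    ∫⁻ y, G y * H (RCPath.shift s y) ∂(Y.lawFrom ν) =
      ∫⁻ y, G y * ∫⁻ w, H w ∂(Y.law (y.1 s)) ∂(Y.lawFrom ν) := by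
  have hQ := Y.isProbabilityMeasure_lawFrom ν
  have hG' : Measurable G := hG.mono (RCPath.past_le s) le_rfl
  have h1 : Measurable fun y : RCPath E => H (RCPath.shift s y) :=
    hH.comp (RCPath.measurable_shift s)
  have h2 : AEMeasurable (fun y : RCPath E => ∫⁻ w, H w ∂(Y.law (y.1 s))) (Y.lawFrom ν) :=
    (Measure.measurable_lintegral hH).comp_aemeasurable (Y.aemeasurable_law_apply _ s)
  -- The Markov property on past events says that the two densities define the same measure on the
  -- past σ-algebra; such measures agree on the past-measurable `G`.
  have h : ((Y.lawFrom ν).withDensity fun y => H (RCPath.shift s y)).trim (RCPath.past_le s) =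
      ((Y.lawFrom ν).withDensity fun y => ∫⁻ w, H w ∂(Y.law (y.1 s))).trim (RCPath.past_le s) := by
    refine @Measure.ext _ (RCPath.past s) _ _ fun A hA => ?_
    rw [trim_measurableSet_eq _ hA, trim_measurableSet_eq _ hA,
      withDensity_apply _ (RCPath.past_le s A hA), withDensity_apply _ (RCPath.past_le s A hA),
      Y.setLIntegral_shift ν s hA hH]
  have h3 := congrArg (fun P : @Measure (RCPath E) (RCPath.past s) =>
    @lintegral _ (RCPath.past s) P G) h
  simp only [lintegral_trim _ hG] at h3
  rw [lintegral_withDensity_eq_lintegral_mul₀ h1.aemeasurable hG'.aemeasurable,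
    lintegral_withDensity_eq_lintegral_mul₀ h2 hG'.aemeasurable] at h3
  simpa only [Pi.mul_apply, mul_comm] using h3

end Markov

/-! ### The occupation measure of a tour -/

theorem restoreMean_le_one {E : Type*} [TopologicalSpace E] [MeasurableSpace E]
    (κ : E → ℝ≥0) (Q : Measure (RCPath E)) [IsProbabilityMeasure Q]
    {f : E → ℝ≥0∞}
    (hf : ∀ x, f x ≤ 1) (t : ℝ≥0) : restoreMean κ Q f t ≤ 1 :=
  (lintegral_mono fun _ => hf _).trans (by simp)

section Occupation

attribute [local irreducible] lifetime cumRate restorePath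

variable {E : Type*} [TopologicalSpace E] [MeasurableSpace E] [BorelSpace E]
  [TopologicalSpace.PseudoMetrizableSpace E] {κ : E → ℝ≥0}

/-- The law of the position at time `s`, restricted to tours that last longer than `s`. -/
noncomputable def tourMarginal (κ : E → ℝ≥0) (Q : Measure (RCPath E)) (s : ℝ≥0) : Measure E :=
  (Q.withDensity fun y => expTail (cumRate κ y s)).map fun y => y.1 s

/-- The expected occupation measure of a tour. -/
noncomputable def tourOccupation (κ : E → ℝ≥0) (Q : Measure (RCPath E)) : Measure E :=
  timeMeasure.bind (tourMarginal κ Q)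

theorem measurable_expTail_cumRate (hκ : Measurable κ) (s : ℝ≥0) :
    Measurable fun y : RCPath E => expTail (cumRate κ y s) := by
  have h := (measurable_cumRate (E := E) hκ).comp (measurable_prodMk_right (y := s))
  exact measurable_expTail.comp h

theorem lintegral_tourMarginal (hκ : Measurable κ) (Q : Measure (RCPath E))
    [IsFiniteMeasure Q] (s : ℝ≥0) {h : E → ℝ≥0∞} (hh : UniversallyMeasurable h) :
    ∫⁻ x, h x ∂(tourMarginal κ Q s) = ∫⁻ y, expTail (cumRate κ y s) * h (y.1 s) ∂Q := by
  have hm := measurable_expTail_cumRate (E := E) hκ s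
  have h1 : AEMeasurable (fun y : RCPath E => h (y.1 s)) Q :=
    (hh (Q.map fun y : RCPath E => y.1 s) inferInstance).comp_measurable (RCPath.measurable_apply s)
  have hac : Q.withDensity (fun y => expTail (cumRate κ y s)) ≪ Q :=
    withDensity_absolutelyContinuous _ _
  have hfin : IsFiniteMeasure (Q.withDensity fun y => expTail (cumRate κ y s)) := by
    refine isFiniteMeasure_withDensity (ne_top_of_le_ne_top (measure_ne_top Q univ) ?_)
    exact (lintegral_mono fun y => expTail_le_one _).trans (by simp)
  rw [tourMarginal, lintegral_map' (hh _ inferInstance) (RCPath.measurable_apply s).aemeasurable,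
    lintegral_withDensity_eq_lintegral_mul₀ hm.aemeasurable h1]
  rfl

theorem measurable_tourMarginal (hκ : Measurable κ) (Q : Measure (RCPath E))
    [IsFiniteMeasure Q] : Measurable (tourMarginal κ Q) := by
  refine Measure.measurable_of_measurable_coe _ fun B hB => ?_
  have hf : Measurable (B.indicator (1 : E → ℝ≥0∞)) := measurable_one.indicator hB
  have h : ∀ s, tourMarginal κ Q s B =
      ∫⁻ y, expTail (cumRate κ y s) * B.indicator 1 (y.1 s) ∂Q := fun s => by
    rw [← lintegral_tourMarginal hκ Q s fun _ _ => hf.aemeasurable, lintegral_indicator_one hB]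
  simp_rw [h]
  exact Measurable.lintegral_prod_left' (μ := Q) (f := fun p : RCPath E × ℝ≥0 =>
    expTail (cumRate κ p.1 p.2) * B.indicator 1 (p.1.1 p.2)) (measurable_expTail_mul hκ hf)

/-- Transition functions are merely universally measurable, a property tested on finite measures
only; hence the finiteness of the occupation measure. -/
theorem lintegral_tourOccupation (hκ : Measurable κ) (Q : Measure (RCPath E))
    [IsFiniteMeasure Q] [IsFiniteMeasure (tourOccupation κ Q)] {h : E → ℝ≥0∞}
    (hh : UniversallyMeasurable h) :
    ∫⁻ x, h x ∂(tourOccupation κ Q) =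
      ∫⁻ s, ∫⁻ y, expTail (cumRate κ y s) * h (y.1 s) ∂Q ∂timeMeasure := by
  have := hh (tourOccupation κ Q) inferInstance
  rw [tourOccupation, Measure.lintegral_bind (measurable_tourMarginal hκ Q).aemeasurable this]
  exact lintegral_congr fun s => lintegral_tourMarginal hκ Q s hh

theorem tourOccupation_apply (hκ : Measurable κ) (Q : Measure (RCPath E))
    [IsFiniteMeasure Q] {B : Set E} (hB : MeasurableSet B) :
    tourOccupation κ Q B =
      ∫⁻ s, ∫⁻ y, expTail (cumRate κ y s) * B.indicator 1 (y.1 s) ∂Q ∂timeMeasure := by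
  have hf : Measurable (B.indicator (1 : E → ℝ≥0∞)) := measurable_one.indicator hB
  rw [tourOccupation, Measure.bind_apply hB (measurable_tourMarginal hκ Q).aemeasurable]
  refine lintegral_congr fun s => ?_
  rw [← lintegral_tourMarginal hκ Q s fun _ _ => hf.aemeasurable, lintegral_indicator_one hB]

theorem delayed_add (u : ℝ≥0 → ℝ≥0∞) (s t : ℝ≥0) (σ : ℝ≥0∞) :
    delayed u (s + t) (s + σ) = delayed u t σ := by
  simp only [delayed, ENNReal.coe_add, ENNReal.add_le_add_iff_left ENNReal.coe_ne_top,
    ENNReal.add_sub_add_eq_sub_left ENNReal.coe_ne_top]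

/-- Memorylessness: with the weight of survival up to `s`, a fresh clock on the shifted path is the
old clock restricted to lifetimes beyond `s`. -/
theorem expTail_mul_firstTour_shift (hκ : Measurable κ) (hloc : LocallyBounded κ)
    (f : E → ℝ≥0∞) {u : ℝ≥0 → ℝ≥0∞} (hu : Measurable u) (s t : ℝ≥0) (y : RCPath E) :
    expTail (cumRate κ y s) * firstTour κ f u t (RCPath.shift s y) =
      expTail (cumRate κ y (s + t)) * f (y.1 (s + t)) +
        ∫⁻ ξ in {ξ | (s : ℝ≥0∞) < lifetime κ y ξ}, delayed u (s + t) (lifetime κ y ξ)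
          ∂(expMeasure 1) := by
  have h1 : Measurable fun σ : ℝ≥0∞ => delayed u (s + t) σ :=
    (measurable_delayed hu).comp measurable_prodMk_left
  rw [lintegral_lifetime_tail hκ hloc y s h1]
  simp_rw [delayed_add]
  rw [firstTour, mul_add, cumRate_add hκ, expTail_add, mul_assoc]
  rfl

/-- With r = s + t the first integral runs over [t, t + σ), so together they cover [0, t + σ). The
delayed function vanishes before σ, and what is left is `u` on [0, t) moved by σ. -/
theorem lintegral_delayed_add (u : ℝ≥0 → ℝ≥0∞) (hu : Measurable u) (t : ℝ≥0) {σ : ℝ≥0∞}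
    (hσ : σ ≠ ∞) :
    ∫⁻ s, {s : ℝ≥0 | (s : ℝ≥0∞) < σ}.indicator (fun s => delayed u (s + t) σ) s ∂timeMeasure +
      ∫⁻ r in Iio t, delayed u r σ ∂timeMeasure = ∫⁻ r in Iio t, u r ∂timeMeasure := by
  lift σ to ℝ≥0 using hσ
  have hd : Measurable fun r => delayed u r σ :=
    (measurable_delayed hu).comp measurable_prodMk_right
  have hF : Measurable ((Iio (t + σ)).indicator fun r => delayed u r σ) :=
    hd.indicator measurableSet_Iio
  have h1 : ∫⁻ s, {s : ℝ≥0 | (s : ℝ≥0∞) < σ}.indicator (fun s => delayed u (s + t) σ) s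
      ∂timeMeasure = ∫⁻ r in Ici t, (Iio (t + σ)).indicator (fun r => delayed u r σ) r
        ∂timeMeasure := by
    rw [← lintegral_timeMeasure_add t hF]
    refine lintegral_congr fun s => ?_
    simp [indicator, add_comm s t]
  have h2 : ∫⁻ r in Iio t, delayed u r σ ∂timeMeasure =
      ∫⁻ r in Iio t, (Iio (t + σ)).indicator (fun r => delayed u r σ) r ∂timeMeasure := by
    refine setLIntegral_congr_fun measurableSet_Iio fun r hr => ?_
    have h : r ∈ Iio (t + σ) := mem_Iio.2 (lt_of_lt_of_le (mem_Iio.1 hr) le_self_add)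
    simp only [indicator_of_mem h]
  have h3 := lintegral_add_compl ((Iio (t + σ)).indicator fun r => delayed u r σ)
    (measurableSet_Ici (a := t)) (μ := timeMeasure)
  rw [compl_Ici] at h3
  have h4 := lintegral_timeMeasure_add σ (f := (Iio (t + σ)).indicator fun r => u (r - σ))
    ((by fun_prop : Measurable fun r => u (r - σ)).indicator measurableSet_Iio)
  rw [h1, h2, h3, ← lintegral_indicator measurableSet_Iio]
  trans ∫⁻ r in Ici σ, (Iio (t + σ)).indicator (fun r => u (r - σ)) r ∂timeMeasure
  · rw [← lintegral_indicator measurableSet_Ici]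
    refine lintegral_congr fun r => ?_
    simp only [indicator, delayed, mem_Iio, mem_Ici, ENNReal.coe_le_coe]
    split_ifs <;> simp [← ENNReal.coe_sub]
  · rw [← h4]
    refine lintegral_congr fun r => ?_
    simp [indicator, add_comm σ r]

theorem delayed_le_one {u : ℝ≥0 → ℝ≥0∞} (hu : ∀ t, u t ≤ 1) (t : ℝ≥0) (σ : ℝ≥0∞) :
    delayed u t σ ≤ 1 := by
  unfold delayed
  split_ifs
  exacts [hu _, zero_le]

/-- Splitting at the next regeneration gives ∫_t^∞ g from the current tour and `W` from later ones;
the integrated renewal equation identifies `W` with the missing ∫₀ᵗ g. -/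
theorem lintegral_restoreTransition_tourOccupation (hκ : Measurable κ) (hloc : LocallyBounded κ)
    (Y : RightProcess E) (ν : Measure E) [IsProbabilityMeasure ν]
    (hfin : ∀ᵐ y ∂(Y.lawFrom ν), ∀ᵐ ξ ∂(expMeasure 1), lifetime κ y ξ ≠ ∞)
    [IsFiniteMeasure (tourOccupation κ (Y.lawFrom ν))] {f : E → ℝ≥0∞} (hf : Measurable f)
    (hf1 : ∀ x, f x ≤ 1) (t : ℝ≥0) :
    ∫⁻ x, ∫⁻ a, f a ∂(restoreTransition Y κ ν t x) ∂(tourOccupation κ (Y.lawFrom ν)) =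
      ∫⁻ x, f x ∂(tourOccupation κ (Y.lawFrom ν)) := by
  have hQ := Y.isProbabilityMeasure_lawFrom ν
  set Q := Y.lawFrom ν with hQdef
  set u := restoreMean κ Q f with hu_def
  have hu : Measurable u := measurable_restoreMean hκ hloc Q hf
  have hu1 : ∀ t, u t ≤ 1 := restoreMean_le_one κ Q hf1
  have hft : Measurable (firstTour κ f u t) := by
    have h := (measurable_firstTour hκ hloc hf hu).comp (measurable_prodMk_right (y := t))
    exact h
  have hg2 := measurable_expTail_mul hκ hf
  set g : ℝ≥0 → ℝ≥0∞ := fun s => ∫⁻ y, expTail (cumRate κ y s) * f (y.1 s) ∂Q with hg_def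
  have hg : Measurable g := hg2.lintegral_prod_left'
  have hlife := measurable_lifetime (E := E) hκ hloc
  have hdel : Measurable fun q : (RCPath E × ℝ) × ℝ≥0 => delayed u q.2 (lifetime κ q.1.1 q.1.2) :=
    (measurable_delayed hu).comp (measurable_snd.prodMk (hlife.comp measurable_fst))
  have htail : Measurable fun q : (RCPath E × ℝ) × ℝ≥0 =>
      {s : ℝ≥0 | (s : ℝ≥0∞) < lifetime κ q.1.1 q.1.2}.indicator
        (fun s => delayed u (s + t) (lifetime κ q.1.1 q.1.2)) q.2 := by
    have h1 : MeasurableSet {q : (RCPath E × ℝ) × ℝ≥0 |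
        (q.2 : ℝ≥0∞) < lifetime κ q.1.1 q.1.2} :=
      measurableSet_lt (by fun_prop) (hlife.comp measurable_fst)
    have h2 : Measurable fun q : (RCPath E × ℝ) × ℝ≥0 =>
        delayed u (q.2 + t) (lifetime κ q.1.1 q.1.2) :=
      (measurable_delayed hu).comp ((measurable_snd.add_const t).prodMk (hlife.comp measurable_fst))
    exact h2.indicator h1
  have hclock : ∀ {F : (RCPath E × ℝ) → ℝ≥0∞}, Measurable F →
      ∫⁻ p, F p ∂(clockedLaw Q) = ∫⁻ y, ∫⁻ ξ, F (y, ξ) ∂(expMeasure 1) ∂Q := fun hF => by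
    rw [clockedLaw, lintegral_prod _ hF.aemeasurable]
  -- the renewal equation, integrated over `[0, t)`
  set D : ℝ≥0∞ := ∫⁻ r in Iio t, ∫⁻ p, delayed u r (lifetime κ p.1 p.2) ∂(clockedLaw Q)
    ∂timeMeasure with hD
  -- Finiteness allows `D` to be cancelled between the two expressions for the integral of `u`.
  have hDfin : D ≠ ∞ := by
    have h1 : D ≤ ∫⁻ r in Iio t, 1 ∂timeMeasure := by
      refine lintegral_mono fun r => ?_
      exact (lintegral_mono fun p => delayed_le_one hu1 r _).trans (by simp)
    refine ne_top_of_le_ne_top ?_ h1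
    simp [timeMeasure_Iio]
  have hren : ∫⁻ r in Iio t, u r ∂timeMeasure = ∫⁻ r in Iio t, g r ∂timeMeasure + D := by
    rw [hD, ← lintegral_add_left hg]
    refine lintegral_congr fun r => ?_
    have hgr : Measurable fun y : RCPath E => expTail (cumRate κ y r) * f (y.1 r) := by
      have h := hg2.comp (measurable_prodMk_right (y := r))
      exact h
    have h1 : Measurable fun p : RCPath E × ℝ => delayed u r (lifetime κ p.1 p.2) := by
      have h := hdel.comp (measurable_prodMk_right (y := r))
      exact h
    rw [hu_def, restoreMean_eq hκ hloc Q hf, hclock h1, ← lintegral_add_left hgr]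
    rfl
  set W : ℝ≥0∞ := ∫⁻ s, ∫⁻ y, ∫⁻ ξ in {ξ | (s : ℝ≥0∞) < lifetime κ y ξ},
    delayed u (s + t) (lifetime κ y ξ) ∂(expMeasure 1) ∂Q ∂timeMeasure with hW
  have hW' : W = ∫⁻ p, ∫⁻ s, {s : ℝ≥0 | (s : ℝ≥0∞) < lifetime κ p.1 p.2}.indicator
      (fun s => delayed u (s + t) (lifetime κ p.1 p.2)) s ∂timeMeasure ∂(clockedLaw Q) := by
    rw [lintegral_lintegral_swap htail.aemeasurable, hW]
    refine lintegral_congr fun s => ?_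
    have h1 : Measurable fun p : RCPath E × ℝ =>
        {s : ℝ≥0 | (s : ℝ≥0∞) < lifetime κ p.1 p.2}.indicator
          (fun s => delayed u (s + t) (lifetime κ p.1 p.2)) s := by
      have h := htail.comp (measurable_prodMk_right (y := s))
      exact h
    rw [hclock h1]
    refine lintegral_congr fun y => ?_
    rw [← lintegral_indicator
      (measurableSet_lt measurable_const (measurable_lifetime_right hκ hloc y))]
    rfl
  -- Tonelli reduces this to a single tour, where `lintegral_delayed_add` gives a value independent
  -- of the lifetime as long as that is finite.
  have hWD : W + D = ∫⁻ r in Iio t, u r ∂timeMeasure := by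
    have hD' : D = ∫⁻ p, ∫⁻ r in Iio t, delayed u r (lifetime κ p.1 p.2) ∂timeMeasure
        ∂(clockedLaw Q) := (lintegral_lintegral_swap hdel.aemeasurable).symm
    rw [hW', hD', ← lintegral_add_left htail.lintegral_prod_right']
    have hae : ∀ᵐ p ∂(clockedLaw Q), lifetime κ p.1 p.2 ≠ ∞ := by
      have hs : MeasurableSet {p : RCPath E × ℝ | lifetime κ p.1 p.2 ≠ ∞} :=
        (measurableSet_singleton ∞).compl.preimage hlife
      exact (Measure.ae_prod_iff_ae_ae hs).2 hfin
    trans ∫⁻ _, (∫⁻ r in Iio t, u r ∂timeMeasure) ∂(clockedLaw Q)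
    · refine lintegral_congr_ae ?_
      filter_upwards [hae] with p hp using lintegral_delayed_add u hu t hp
    · simp
  have hWg : W = ∫⁻ r in Iio t, g r ∂timeMeasure := by
    rw [hren] at hWD
    exact (ENNReal.add_left_inj hDfin).1 hWD
  have hh : UniversallyMeasurable fun x => ∫⁻ y, firstTour κ f u t y ∂(Y.law x) :=
    fun η hη => (Measure.measurable_lintegral hft).comp_aemeasurable (Y.meas η hη)
  simp_rw [lintegral_restoreTransition hκ hloc Y ν hf]
  rw [lintegral_tourOccupation hκ Q hh, lintegral_tourOccupation hκ Q fun _ _ => hf.aemeasurable]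
  -- The Markov property at time `s`, with the survival probability as past factor, replaces a
  -- restart from the current position by the continuation of the tour.
  have h1 : ∀ s, ∫⁻ y, expTail (cumRate κ y s) * ∫⁻ w, firstTour κ f u t w ∂(Y.law (y.1 s)) ∂Q =
      g (t + s) + ∫⁻ y, ∫⁻ ξ in {ξ | (s : ℝ≥0∞) < lifetime κ y ξ},
        delayed u (s + t) (lifetime κ y ξ) ∂(expMeasure 1) ∂Q := fun s => by
    have hp : Measurable[RCPath.past s] fun y : RCPath E => expTail (cumRate κ y s) :=
      measurable_expTail.comp (measurable_past_cumRate hκ s)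
    have hgr : Measurable fun y : RCPath E =>
        expTail (cumRate κ y (s + t)) * f (y.1 (s + t)) := by
      have h := hg2.comp (measurable_prodMk_right (y := s + t))
      exact h
    rw [hQdef, ← Y.lintegral_mul_shift ν s hp hft]
    simp_rw [expTail_mul_firstTour_shift hκ hloc f hu]
    rw [lintegral_add_left hgr, add_comm t s]
  have hgt : Measurable fun s => g (t + s) := hg.comp (measurable_const_add t)
  simp_rw [h1]
  rw [lintegral_add_left hgt, ← hW, hWg, lintegral_timeMeasure_add t hg, ← compl_Ici,
    lintegral_add_compl _ measurableSet_Ici]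

end Occupation

/-! ### Uniqueness of the invariant distribution -/

section Uniqueness

attribute [local irreducible] lifetime cumRate restorePath

variable {E : Type*} [TopologicalSpace E] [MeasurableSpace E] [BorelSpace E]
  [TopologicalSpace.PseudoMetrizableSpace E] {κ : E → ℝ≥0}

theorem restoreTransition_apply (hκ : Measurable κ) (hloc : LocallyBounded κ)
    (Y : RightProcess E) (ν : Measure E) [IsProbabilityMeasure ν] {B : Set E}
    (hB : MeasurableSet B) (t : ℝ≥0) (x : E) :
    restoreTransition Y κ ν t x B =
      ∫⁻ y, firstTour κ (B.indicator 1) (restoreMean κ (Y.lawFrom ν) (B.indicator 1)) t y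
        ∂(Y.law x) := by
  rw [← lintegral_restoreTransition hκ hloc Y ν (measurable_one.indicator hB),
    lintegral_indicator_one hB]

theorem isProbabilityMeasure_restoreTransition (hκ : Measurable κ) (hloc : LocallyBounded κ)
    (Y : RightProcess E) (ν : Measure E) [IsProbabilityMeasure ν] (t : ℝ≥0) (x : E) :
    IsProbabilityMeasure (restoreTransition Y κ ν t x) := by
  have := isProbabilityMeasure_driverLaw Y ν x
  exact Measure.isProbabilityMeasure_map (measurable_restorePath_apply hκ hloc t).aemeasurable

theorem measurable_firstTour_indicator (hκ : Measurable κ) (hloc : LocallyBounded κ)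
    (Q : Measure (RCPath E)) [IsProbabilityMeasure Q] {B : Set E} (hB : MeasurableSet B) :
    Measurable fun p : RCPath E × ℝ≥0 =>
      firstTour κ (B.indicator 1) (restoreMean κ Q (B.indicator 1)) p.2 p.1 :=
  have hf : Measurable (B.indicator (1 : E → ℝ≥0∞)) := measurable_one.indicator hB
  measurable_firstTour hκ hloc hf (measurable_restoreMean hκ hloc Q hf)

theorem universallyMeasurable_restoreTransition (hκ : Measurable κ) (hloc : LocallyBounded κ)
    (Y : RightProcess E) (ν : Measure E) [IsProbabilityMeasure ν] {B : Set E}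
    (hB : MeasurableSet B) (t : ℝ≥0) :
    UniversallyMeasurable fun x => restoreTransition Y κ ν t x B := fun η hη => by
  have hQ := Y.isProbabilityMeasure_lawFrom ν
  simp_rw [restoreTransition_apply hκ hloc Y ν hB]
  have h := (measurable_firstTour_indicator hκ hloc (Y.lawFrom ν) hB).comp
    (measurable_prodMk_right (y := t))
  exact (Measure.measurable_lintegral h).comp_aemeasurable (Y.meas η hη)

/-- A nonzero invariant measure charges every set that the irreducibility measure charges. -/
theorem IsRestoreInvariant.pos_of_forall_occupation_pos (hκ : Measurable κ)
    (hloc : LocallyBounded κ) (Y : RightProcess E) (ν : Measure E) [IsProbabilityMeasure ν]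
    {ρ : Measure E} [IsFiniteMeasure ρ] (hρ : ρ ≠ 0) (hinv : IsRestoreInvariant Y κ ν ρ)
    {B : Set E} (hB : MeasurableSet B)
    (hpos : ∀ x, 0 < ∫⁻ t in Ici (0 : ℝ), restoreTransition Y κ ν t.toNNReal x B) :
    0 < ρ B := by
  by_contra hn
  have hρB : ρ B = 0 := by simpa using hn
  have hQ := Y.isProbabilityMeasure_lawFrom ν
  have hY := Y.meas ρ inferInstance
  have hP : IsFiniteMeasure (Y.lawFrom ρ) := by
    refine ⟨?_⟩
    have h1 : ∀ x, Y.law x univ = 1 := fun x => (Y.prob x).measure_univ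
    rw [RightProcess.lawFrom, Measure.bind_apply MeasurableSet.univ hY]
    simp [h1, measure_lt_top]
  have hF := measurable_firstTour_indicator hκ hloc (Y.lawFrom ν) hB
  set F : RCPath E → ℝ≥0 → ℝ≥0∞ := fun y t =>
    firstTour κ (B.indicator 1) (restoreMean κ (Y.lawFrom ν) (B.indicator 1)) t y with hFdef
  have hF1 : Measurable (Function.uncurry F) := hF
  have hH : Measurable fun y => ∫⁻ t, F y t ∂timeMeasure := hF1.lintegral_prod_right'
  -- As a path integral the occupation time has an integrand jointly measurable in path and time, so
  -- Tonelli applies although `Y.law` is only universally measurable.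
  have hK : ∀ x, ∫⁻ t in Ici (0 : ℝ), restoreTransition Y κ ν t.toNNReal x B =
      ∫⁻ y, ∫⁻ t, F y t ∂timeMeasure ∂(Y.law x) := fun x => by
    have := Y.prob x
    simp_rw [restoreTransition_apply hκ hloc Y ν hB]
    have hm : Measurable fun t => ∫⁻ y, F y t ∂(Y.law x) := hF1.lintegral_prod_left'
    rw [lintegral_lintegral_swap hF1.aemeasurable, lintegral_timeMeasure hm]
  have h0 : ∫⁻ x, (∫⁻ t in Ici (0 : ℝ), restoreTransition Y κ ν t.toNNReal x B) ∂ρ = 0 := by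
    simp_rw [hK]
    rw [← Measure.lintegral_bind hY hH.aemeasurable]
    change ∫⁻ y, ∫⁻ t, F y t ∂timeMeasure ∂(Y.lawFrom ρ) = 0
    rw [lintegral_lintegral_swap hF1.aemeasurable]
    have h2 : ∀ t, ∫⁻ y, F y t ∂(Y.lawFrom ρ) = 0 := fun t => by
      have h3 : Measurable fun y => F y t := by
        have h := hF1.comp (measurable_prodMk_right (y := t))
        exact h
      rw [RightProcess.lawFrom, Measure.lintegral_bind hY h3.aemeasurable, ← hρB,
        ← hinv t B hB]
      exact lintegral_congr fun x => (restoreTransition_apply hκ hloc Y ν hB t x).symm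
    simp [h2]
  have hKm : AEMeasurable (fun x => ∫⁻ t in Ici (0 : ℝ), restoreTransition Y κ ν t.toNNReal x B)
      ρ := by
    simp_rw [hK]
    exact (Measure.measurable_lintegral hH).comp_aemeasurable hY
  rw [lintegral_eq_zero_iff' hKm] at h0
  have : ∀ᵐ x ∂ρ, False := by
    filter_upwards [h0] with x hx using (hpos x).ne' hx
  exact hρ (by simpa using this)

theorem IsRestoreInvariant.unique (hκ : Measurable κ) (hloc : LocallyBounded κ)
    {Y : RightProcess E} {ν : Measure E} [IsProbabilityMeasure ν]
    (hirr : IsRestoreIrreducible Y κ ν) {π₁ π₂ : Measure E} [IsProbabilityMeasure π₁]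
    [IsProbabilityMeasure π₂] (h₁ : IsRestoreInvariant Y κ ν π₁)
    (h₂ : IsRestoreInvariant Y κ ν π₂) : π₁ = π₂ := by
  obtain ⟨φ, -, hφ0, hφ⟩ := hirr
  obtain ⟨S, hS, hS1, hS2⟩ := hahn_decomposition π₁ π₂
  -- The minimum of the two measures: the Hahn decomposition gives π₂ ≤ π₁ inside `S` and π₁ ≤ π₂
  -- outside.
  set ρ : Measure E := π₂.restrict S + π₁.restrict Sᶜ with hρ
  have hρB : ∀ B, MeasurableSet B → ρ B = π₂ (B ∩ S) + π₁ (B ∩ Sᶜ) := fun B hB => by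
    simp [hρ, Measure.restrict_apply hB]
  have hρ1 : ρ ≤ π₁ := Measure.le_iff.2 fun B hB => by
    rw [hρB B hB, ← measure_inter_add_sdiff B hS]
    exact add_le_add (hS1 _ (hB.inter hS) inter_subset_right) le_rfl
  have hρ2 : ρ ≤ π₂ := Measure.le_iff.2 fun B hB => by
    rw [hρB B hB, ← measure_inter_add_sdiff B hS]
    exact add_le_add le_rfl (hS2 _ (hB.inter hS.compl) inter_subset_right)
  have hρfin : IsFiniteMeasure ρ := isFiniteMeasure_of_le π₁ hρ1
  -- The minimum is subinvariant: split the target along `S` and dominate ρ by π₂ on one part and by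
  -- π₁ on the other.
  have hle : ∀ t B, MeasurableSet B → ∫⁻ x, restoreTransition Y κ ν t x B ∂ρ ≤ ρ B := by
    intro t B hB
    have hu := universallyMeasurable_restoreTransition hκ hloc Y ν (hB.inter hS) t ρ inferInstance
    calc ∫⁻ x, restoreTransition Y κ ν t x B ∂ρ
        = ∫⁻ x, restoreTransition Y κ ν t x (B ∩ S) ∂ρ +
            ∫⁻ x, restoreTransition Y κ ν t x (B ∩ Sᶜ) ∂ρ := by
          rw [← lintegral_add_left' hu]
          exact lintegral_congr fun x => (measure_inter_add_sdiff B hS).symm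
      _ ≤ ∫⁻ x, restoreTransition Y κ ν t x (B ∩ S) ∂π₂ +
            ∫⁻ x, restoreTransition Y κ ν t x (B ∩ Sᶜ) ∂π₁ :=
          add_le_add (lintegral_mono' hρ2 le_rfl) (lintegral_mono' hρ1 le_rfl)
      _ = ρ B := by rw [h₂ t _ (hB.inter hS), h₁ t _ (hB.inter hS.compl), hρB B hB]
  -- The transition kernels preserve the finite total mass, so a deficit on `B` would force an
  -- excess on its complement.
  have hρinv : IsRestoreInvariant Y κ ν ρ := by
    intro t B hB
    refine le_antisymm (hle t B hB) ?_
    have hu := universallyMeasurable_restoreTransition hκ hloc Y ν hB t ρ inferInstance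
    have hsum : ∫⁻ x, restoreTransition Y κ ν t x B ∂ρ +
        ∫⁻ x, restoreTransition Y κ ν t x Bᶜ ∂ρ = ρ B + ρ Bᶜ := by
      rw [← lintegral_add_left' hu, measure_add_measure_compl hB]
      have h1 : ∀ x, restoreTransition Y κ ν t x B + restoreTransition Y κ ν t x Bᶜ = 1 :=
        fun x => by
          have := isProbabilityMeasure_restoreTransition hκ hloc Y ν t x
          rw [measure_add_measure_compl hB, measure_univ]
      simp [h1]
    have hc := hle t Bᶜ hB.compl
    refine (ENNReal.add_le_add_iff_right (measure_ne_top ρ Bᶜ)).1 ?_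
    rw [← hsum]
    gcongr
  have hdiff : ∀ π : Measure E, IsProbabilityMeasure π → ρ ≤ π → IsRestoreInvariant Y κ ν π →
      IsRestoreInvariant Y κ ν (π - ρ) := by
    intro π hπ hle hinv t B hB
    have h1 := hinv t B hB
    rw [← Measure.sub_add_cancel_of_le hle, lintegral_add_measure, hρinv t B hB,
      Measure.add_apply] at h1
    exact (ENNReal.add_left_inj (measure_ne_top ρ B)).1 h1
  have hd1 : (π₁ - ρ) Sᶜ = 0 := by
    rw [Measure.sub_apply hS.compl hρ1, hρB _ hS.compl]
    simp
  have hd2 : (π₂ - ρ) S = 0 := by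
    rw [Measure.sub_apply hS hρ2, hρB _ hS]
    simp
  have heq : ∀ π : Measure E, IsProbabilityMeasure π → ρ ≤ π → π - ρ = 0 → ρ = π := by
    intro π _ hle h
    rw [← Measure.sub_add_cancel_of_le hle, h, zero_add]
  -- The excesses are invariant and live on complementary sets. If both were nonzero, irreducibility
  -- would make each null set of either one φ-null, so φ would vanish on `S` and on its complement.
  have hcase : π₁ - ρ = 0 ∨ π₂ - ρ = 0 := by
    by_contra hn
    push Not at hn
    have key : ∀ π : Measure E, IsProbabilityMeasure π → ρ ≤ π → IsRestoreInvariant Y κ ν π →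
        π - ρ ≠ 0 → ∀ B, MeasurableSet B → (π - ρ) B = 0 → φ B = 0 := by
      intro π hπ hle hinv hne B hB h0
      by_contra hφB
      have := IsRestoreInvariant.pos_of_forall_occupation_pos hκ hloc Y ν hne
        (hdiff π hπ hle hinv) hB (hφ B hB (pos_iff_ne_zero.2 hφB))
      exact this.ne' h0
    have hφS := key π₂ inferInstance hρ2 h₂ hn.2 S hS hd2
    have hφSc := key π₁ inferInstance hρ1 h₁ hn.1 Sᶜ hS.compl hd1
    apply hφ0
    rw [← Measure.measure_univ_eq_zero, ← measure_add_measure_compl hS, hφS, hφSc, add_zero]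
  -- Once one excess vanishes, ρ is itself a probability measure, and lying below the other one
  -- forces equality.
  have hρ_eq : ∀ π : Measure E, IsProbabilityMeasure π → ρ ≤ π → IsProbabilityMeasure ρ → ρ = π :=
    fun π _ hle _ => Measure.eq_of_le_of_isProbabilityMeasure hle
  rcases hcase with h | h
  · have h1 := heq π₁ inferInstance hρ1 h
    rw [← h1]
    exact hρ_eq π₂ inferInstance hρ2 (h1 ▸ inferInstance)
  · have h1 := heq π₂ inferInstance hρ2 h
    rw [← h1]
    exact (hρ_eq π₁ inferInstance hρ1 (h1 ▸ inferInstance)).symm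

end Uniqueness

/-! ### The Restore process at an independent exponential time -/

section ExponentialTime

attribute [local irreducible] lifetime cumRate restorePath

theorem lintegral_expMeasure_eq (r : ℝ≥0) {f : ℝ≥0 → ℝ≥0∞} (hf : Measurable f) :
    ∫⁻ ξ, f ξ.toNNReal ∂(expMeasure r) = r * ∫⁻ t, expTail (r * t) * f t ∂timeMeasure := by
  have hm : Measurable fun t : ℝ≥0 => expTail (r * t) * f t :=
    (measurable_expTail.comp (by fun_prop)).mul hf
  rw [lintegral_expMeasure hf, ← lintegral_const_mul _ hm]
  refine lintegral_congr fun t => ?_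
  rw [← mul_assoc, ← ENNReal.coe_mul, expTail_coe, ENNReal.ofReal_mul r.coe_nonneg]
  simp

/-- A delay by σ multiplies the Laplace transform by e^{-rσ}. Positivity of `r` matters at σ = ∞,
where `0 * ∞ = 0` would give the wrong factor. -/
theorem lintegral_expTail_mul_delayed (r : ℝ≥0) (hr : 0 < r) {u : ℝ≥0 → ℝ≥0∞} (hu : Measurable u)
    (σ : ℝ≥0∞) :
    ∫⁻ t, expTail (r * t) * delayed u t σ ∂timeMeasure =
      expTail (r * σ) * ∫⁻ t, expTail (r * t) * u t ∂timeMeasure := by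
  have hm : ∀ {v : ℝ≥0 → ℝ≥0∞}, Measurable v → Measurable fun t : ℝ≥0 => expTail (r * t) * v t :=
    fun hv => (measurable_expTail.comp (by fun_prop)).mul hv
  induction σ with
  | top =>
    rw [ENNReal.mul_top (by exact_mod_cast hr.ne'), expTail_top]
    simp [delayed]
  | coe c =>
    have h := lintegral_timeMeasure_add c (hm (v := fun t => u (t - c)) (by fun_prop))
    rw [← lintegral_const_mul _ (hm hu)]
    trans ∫⁻ t in Ici c, expTail (r * t) * u (t - c) ∂timeMeasure
    · rw [← lintegral_indicator measurableSet_Ici]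
      refine lintegral_congr fun t => ?_
      simp only [indicator, delayed, mem_Ici, ENNReal.coe_le_coe]
      split_ifs <;> simp [← ENNReal.coe_sub]
    · rw [← h]
      refine lintegral_congr fun t => ?_
      simp only [ENNReal.coe_add, mul_add, expTail_add, add_tsub_cancel_left, mul_assoc]

theorem lintegral_restoreMean_univ {E : Type*} [TopologicalSpace E] [MeasurableSpace E]
    (κ' : E → ℝ≥0) {r : ℝ≥0} (hr : 0 < r) (Q : Measure (RCPath E))
    [IsProbabilityMeasure Q] :
    ∫⁻ t, restoreMean κ' Q ((univ : Set E).indicator 1) t.toNNReal ∂(expMeasure r) = 1 := by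
  have := isProbabilityMeasure_expMeasure (r := r) (by exact_mod_cast hr)
  simp [restoreMean]

variable {E : Type*} [TopologicalSpace E] [MeasurableSpace E] [BorelSpace E]
  [TopologicalSpace.PseudoMetrizableSpace E] {κ κ' : E → ℝ≥0} {r : ℝ≥0}

/-- The Laplace transform at `r` of the renewal equation of the κ'-process: the first tour
contributes the occupation measure at rate κ, and each regeneration starts the same problem afresh.
-/
theorem lintegral_restoreMean_expMeasure (hκ : Measurable κ) (hκ' : Measurable κ')
    (hloc' : LocallyBounded κ') (hr : 0 < r) (Q : Measure (RCPath E)) [IsProbabilityMeasure Q]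
    (hrate : ∀ᵐ y ∂Q, ∀ s, cumRate κ y s = cumRate κ' y s + r * s)
    {B : Set E} (hB : MeasurableSet B) :
    ∫⁻ t, restoreMean κ' Q (B.indicator 1) t.toNNReal ∂(expMeasure r) =
      r * tourOccupation κ Q B +
        (∫⁻ y, ∫⁻ ξ, expTail (r * lifetime κ' y ξ) ∂(expMeasure 1) ∂Q) *
          ∫⁻ t, restoreMean κ' Q (B.indicator 1) t.toNNReal ∂(expMeasure r) := by
  have hf : Measurable (B.indicator (1 : E → ℝ≥0∞)) := measurable_one.indicator hB
  set f : E → ℝ≥0∞ := B.indicator 1 with hfdef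
  have hu := measurable_restoreMean hκ' hloc' Q hf
  set u := restoreMean κ' Q f with hudef
  have hlife := measurable_lifetime (E := E) hκ' hloc'
  have hdel : Measurable fun q : (RCPath E × ℝ) × ℝ≥0 =>
      expTail (r * q.2) * delayed u q.2 (lifetime κ' q.1.1 q.1.2) := by
    have h := (measurable_delayed hu).comp (measurable_snd.prodMk (hlife.comp measurable_fst))
    have h2 : Measurable fun q : (RCPath E × ℝ) × ℝ≥0 => expTail (r * q.2) :=
      measurable_expTail.comp (by fun_prop)
    exact h2.mul h
  have hg : Measurable fun t => ∫⁻ y, expTail (cumRate κ' y t) * f (y.1 t) ∂Q :=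
    (measurable_expTail_mul (E := E) hκ' hf).lintegral_prod_left'
  have h1 : ∀ t, u t = ∫⁻ y, expTail (cumRate κ' y t) * f (y.1 t) ∂Q +
      ∫⁻ p, delayed u t (lifetime κ' p.1 p.2) ∂(clockedLaw Q) := fun t => by
    have hgt : Measurable fun y : RCPath E => expTail (cumRate κ' y t) * f (y.1 t) := by
      have h := (measurable_expTail_mul (E := E) hκ' hf).comp (measurable_prodMk_right (y := t))
      exact h
    have hdt : Measurable fun p : RCPath E × ℝ => delayed u t (lifetime κ' p.1 p.2) :=
      (measurable_delayed hu).comp (measurable_const.prodMk hlife)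
    rw [hudef, restoreMean_eq hκ' hloc' Q hf, clockedLaw, lintegral_prod _ hdt.aemeasurable,
      ← lintegral_add_left hgt]
    rfl
  have hexp : Measurable fun t : ℝ≥0 => expTail (r * t) := measurable_expTail.comp (by fun_prop)
  have h2 : ∫⁻ t, expTail (r * t) * u t ∂timeMeasure = tourOccupation κ Q B +
      (∫⁻ y, ∫⁻ ξ, expTail (r * lifetime κ' y ξ) ∂(expMeasure 1) ∂Q) *
        ∫⁻ t, expTail (r * t) * u t ∂timeMeasure := by
    have h3 : ∀ t : ℝ≥0, expTail (r * t) * u t =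
        expTail (r * t) * ∫⁻ y, expTail (cumRate κ' y t) * f (y.1 t) ∂Q +
        ∫⁻ p, expTail (r * t) * delayed u t (lifetime κ' p.1 p.2) ∂(clockedLaw Q) := fun t => by
      have hdt : Measurable fun p : RCPath E × ℝ => delayed u t (lifetime κ' p.1 p.2) :=
        (measurable_delayed hu).comp (measurable_const.prodMk hlife)
      rw [lintegral_const_mul _ hdt, ← mul_add, ← h1]
    have h4 : ∫⁻ t, expTail (r * t) * ∫⁻ y, expTail (cumRate κ' y t) * f (y.1 t) ∂Q ∂timeMeasure =
        tourOccupation κ Q B := by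
      rw [tourOccupation_apply hκ Q hB]
      refine lintegral_congr fun t => ?_
      have hgt : Measurable fun y : RCPath E => expTail (cumRate κ' y t) * f (y.1 t) := by
        have h := (measurable_expTail_mul (E := E) hκ' hf).comp (measurable_prodMk_right (y := t))
        exact h
      rw [← lintegral_const_mul _ hgt]
      refine lintegral_congr_ae ?_
      filter_upwards [hrate] with y hy
      -- Surviving both the κ'-clock and the exponential time amounts to surviving the κ-clock,
      -- since the accumulated rates add.
      rw [hy t, expTail_add, ← mul_assoc, mul_comm (expTail (cumRate κ' y t))]
    have h5 : ∫⁻ t, ∫⁻ p, expTail (r * t) * delayed u t (lifetime κ' p.1 p.2) ∂(clockedLaw Q)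
        ∂timeMeasure = (∫⁻ y, ∫⁻ ξ, expTail (r * lifetime κ' y ξ) ∂(expMeasure 1) ∂Q) *
        ∫⁻ t, expTail (r * t) * u t ∂timeMeasure := by
      have hw : Measurable fun p : RCPath E × ℝ => expTail (r * lifetime κ' p.1 p.2) :=
        measurable_expTail.comp (hlife.const_mul _)
      rw [← lintegral_lintegral_swap hdel.aemeasurable]
      simp_rw [lintegral_expTail_mul_delayed r hr hu]
      rw [lintegral_mul_const _ hw, clockedLaw, lintegral_prod _ hw.aemeasurable]
    conv_lhs => rw [funext h3]
    have hg' : Measurable fun t : ℝ≥0 =>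
        expTail (r * t) * ∫⁻ y, expTail (cumRate κ' y t) * f (y.1 t) ∂Q := hexp.mul hg
    rw [lintegral_add_left hg', h4, h5]
  rw [lintegral_expMeasure_eq r hu]
  conv_lhs => rw [h2]
  ring

/-- The law of the Restore process at an independent exponential time. -/
noncomputable def restoreExpLaw (κ' : E → ℝ≥0) (Q : Measure (RCPath E)) (r : ℝ≥0) : Measure E :=
  ((iidLaw Q).prod (expMeasure r)).map fun p => restorePath κ' p.1 p.2.toNNReal

theorem measurable_restorePath_toNNReal (hκ' : Measurable κ') (hloc' : LocallyBounded κ') :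
    Measurable fun p : (ℕ → RCPath E × ℝ) × ℝ => restorePath κ' p.1 p.2.toNNReal := by
  have hm : Measurable fun p : (ℕ → RCPath E × ℝ) × ℝ => (p.1, p.2.toNNReal) := by fun_prop
  have h := (measurable_restorePath hκ' hloc').comp hm
  exact h

theorem restoreExpLaw_apply (hκ' : Measurable κ') (hloc' : LocallyBounded κ') (hr : 0 < r)
    (Q : Measure (RCPath E)) [IsProbabilityMeasure Q] {B : Set E} (hB : MeasurableSet B) :
    restoreExpLaw κ' Q r B =
      ∫⁻ t, restoreMean κ' Q (B.indicator 1) t.toNNReal ∂(expMeasure r) := by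
  have := isProbabilityMeasure_expMeasure (r := r) (by exact_mod_cast hr)
  have hf : Measurable (B.indicator (1 : E → ℝ≥0∞)) := measurable_one.indicator hB
  have hm := measurable_restorePath_toNNReal (E := E) hκ' hloc'
  have hfm : Measurable fun p : (ℕ → RCPath E × ℝ) × ℝ =>
      (B.indicator 1 (restorePath κ' p.1 p.2.toNNReal) : ℝ≥0∞) := hf.comp hm
  rw [restoreExpLaw, ← lintegral_indicator_one hB, lintegral_map hf hm,
    lintegral_prod_symm _ hfm.aemeasurable]
  rfl

/-- The preceding identity is linear in the unknown law with contraction factor `q < 1`, so it can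
be solved; on the whole space it reads 1 = rρ(E) + q, which bounds ρ. -/
theorem restoreExpLaw_eq (hκ : Measurable κ) (hκ' : Measurable κ')
    (hloc' : LocallyBounded κ') (hr : 0 < r) (Q : Measure (RCPath E)) [IsProbabilityMeasure Q]
    (hrate : ∀ᵐ y ∂Q, ∀ s, cumRate κ y s = cumRate κ' y s + r * s) :
    IsFiniteMeasure (tourOccupation κ Q) ∧ IsProbabilityMeasure (restoreExpLaw κ' Q r) ∧
      ∃ c : ℝ≥0∞, restoreExpLaw κ' Q r = c • tourOccupation κ Q := by
  have hr0 : (r : ℝ≥0∞) ≠ 0 := by exact_mod_cast hr.ne'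
  have hq1 : ∫⁻ y, ∫⁻ ξ, expTail (r * lifetime κ' y ξ) ∂(expMeasure 1) ∂Q < 1 :=
    lintegral_lifetime_lt_one hκ' hloc' Q (g := fun a => expTail (r * a)) fun a ha =>
      expTail_lt_one (ENNReal.mul_pos hr0 ha.ne')
  have heq := fun {B : Set E} => lintegral_restoreMean_expMeasure (B := B) hκ hκ' hloc' hr Q hrate
  set q := ∫⁻ y, ∫⁻ ξ, expTail (r * lifetime κ' y ξ) ∂(expMeasure 1) ∂Q
  have hu := heq MeasurableSet.univ
  rw [lintegral_restoreMean_univ κ' hr, mul_one] at hu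
  have hprob : IsProbabilityMeasure (restoreExpLaw κ' Q r) :=
    ⟨by rw [restoreExpLaw_apply hκ' hloc' hr Q MeasurableSet.univ,
      lintegral_restoreMean_univ κ' hr]⟩
  have hle : r * tourOccupation κ Q univ ≤ 1 := by rw [hu]; exact le_self_add
  have hfin : tourOccupation κ Q univ ≠ ∞ := fun h => by
    rw [h, ENNReal.mul_top hr0] at hle
    exact absurd hle (by simp)
  have hq2 : 1 - q ≠ 0 := (tsub_pos_of_lt hq1).ne'
  refine ⟨⟨hfin.lt_top⟩, hprob, (1 - q)⁻¹ * r, Measure.ext fun B hB => ?_⟩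
  have hB' := heq hB
  rw [← restoreExpLaw_apply hκ' hloc' hr Q hB] at hB'
  have hBfin : restoreExpLaw κ' Q r B ≠ ∞ := measure_ne_top _ _
  have h3 : (1 - q) * restoreExpLaw κ' Q r B = r * tourOccupation κ Q B := by
    rw [ENNReal.sub_mul fun _ _ => hBfin, one_mul]
    nth_rewrite 1 [hB']
    exact ENNReal.add_sub_cancel_right (ENNReal.mul_ne_top hq1.ne_top hBfin)
  rw [Measure.smul_apply, smul_eq_mul, mul_assoc, ← h3, ← mul_assoc,
    ENNReal.inv_mul_cancel hq2 (ne_top_of_le_ne_top ENNReal.one_ne_top tsub_le_self), one_mul]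

/-- Dominated convergence along the right-continuous paths. It replaces a random time by times with
countably many values. -/
theorem tendsto_lintegral_restorePath_gridAbove (hκ' : Measurable κ') (hloc' : LocallyBounded κ')
    {Ω : Type*} [MeasurableSpace Ω] (P : Measure Ω) [IsFiniteMeasure P]
    {Z : Ω → ℕ → RCPath E × ℝ} (hZ : Measurable Z)
    (hgood : ∀ᵐ ω ∂P, ∀ t : ℝ≥0, ∃ n, (t : ℝ≥0∞) < regenTime κ' (Z ω) n)
    {T : Ω → ℝ≥0} (hT : Measurable T) (f : BoundedContinuousFunction E ℝ≥0) :
    Tendsto (fun n => ∫⁻ ω, f (restorePath κ' (Z ω) (gridAbove n (T ω))) ∂P) atTop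
      (𝓝 (∫⁻ ω, f (restorePath κ' (Z ω) (T ω)) ∂P)) := by
  have hfm : Measurable fun x => (f x : ℝ≥0∞) := f.continuous.measurable.coe_nnreal_ennreal
  refine tendsto_lintegral_of_dominated_convergence (fun _ => ((nndist f 0 : ℝ≥0) : ℝ≥0∞))
    (fun n => ?_) (fun n => ?_) ?_ ?_
  · have h1 := measurable_apply_gridAbove (X := fun t (z : ℕ → RCPath E × ℝ) => restorePath κ' z t)
      (measurable_restorePath_apply hκ' hloc') n
    have h2 := hfm.comp (h1.comp (hZ.prodMk hT))
    exact h2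
  · refine Eventually.of_forall fun ω => ?_
    exact ENNReal.coe_le_coe.2 (BoundedContinuousFunction.NNReal.upper_bound f _)
  · rw [lintegral_const]
    exact ENNReal.mul_ne_top ENNReal.coe_ne_top (measure_ne_top _ _)
  · filter_upwards [hgood] with ω hω
    have h1 := (continuousWithinAt_restorePath hω (T ω)).tendsto.comp (tendsto_gridAbove (T ω))
    exact (ENNReal.continuous_coe.tendsto _).comp ((f.continuous.tendsto _).comp h1)

/-- The law of a Restore process at an independent exponential time is `restoreExpLaw`. -/
theorem map_restorePath_exp_eq (hκ' : Measurable κ') (hloc' : LocallyBounded κ') (hr : 0 < r)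
    (Y : RightProcess E) (ν : Measure E) [IsProbabilityMeasure ν] {Ω : Type*} [MeasurableSpace Ω]
    (Pr : Measure Ω) [IsProbabilityMeasure Pr] {z : ℕ → Ω → RCPath E × ℝ} {T : Ω → ℝ}
    (hz : DrivesRestore Y ν Pr z) (hT : Measurable T) (hTlaw : Pr.map T = expMeasure r)
    (hind : IndepFun (fun ω t => restorePath κ' (fun i => z i ω) t) T Pr) :
    Pr.map (fun ω => restorePath κ' (fun i => z i ω) (T ω).toNNReal) =
      restoreExpLaw κ' (Y.lawFrom ν) r := by
  have hQ := Y.isProbabilityMeasure_lawFrom ν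
  have hexp := isProbabilityMeasure_expMeasure (r := r) (by exact_mod_cast hr)
  set Q := Y.lawFrom ν
  have hZ : Measurable fun ω i => z i ω := measurable_pi_lambda _ hz.measurable
  have hZlaw : Pr.map (fun ω i => z i ω) = iidLaw Q := by
    rw [hz.indep.map_fun_eq_infinitePi_map hz.measurable]
    simp_rw [hz.law]
    rfl
  have hgood := ae_iidLaw_exists_lt_regenTime hκ' hloc' Q
  have hTn : Measurable fun ω => (T ω).toNNReal := hT.real_toNNReal
  have hm := measurable_restorePath_toNNReal (E := E) hκ' hloc'
  have hXT : Measurable fun ω => restorePath κ' (fun i => z i ω) (T ω).toNNReal := by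
    have h := hm.comp (hZ.prodMk hT)
    exact h
  have hpath : Measurable fun (w : ℕ → RCPath E × ℝ) (t : ℝ≥0) => restorePath κ' w t :=
    measurable_pi_lambda _ (measurable_restorePath_apply hκ' hloc')
  have hpathZ : Measurable fun ω (t : ℝ≥0) => restorePath κ' (fun i => z i ω) t := by
    have h := hpath.comp hZ
    exact h
  -- Independence concerns only the coordinates of X, so the joint law is known just on the product
  -- σ-algebra, where evaluation at a random time need not be measurable.
  have hjoint : Pr.map (fun ω => ((fun t => restorePath κ' (fun i => z i ω) t), T ω)) =
      ((iidLaw Q).prod (expMeasure r)).map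
        (Prod.map (fun w (t : ℝ≥0) => restorePath κ' w t) id) := by
    rw [(indepFun_iff_map_prod_eq_prod_map_map hpathZ.aemeasurable hT.aemeasurable).1 hind, hTlaw,
      ← Measure.map_prod_map _ _ hpath measurable_id, Measure.map_id, ← hZlaw,
      Measure.map_map hpath hZ]
    rfl
  have : IsProbabilityMeasure
      (Pr.map fun ω => restorePath κ' (fun i => z i ω) (T ω).toNNReal) :=
    Measure.isProbabilityMeasure_map hXT.aemeasurable
  let := TopologicalSpace.pseudoMetrizableSpacePseudoMetric E
  refine ext_of_forall_lintegral_eq_of_IsFiniteMeasure fun f => ?_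
  have hfm : Measurable fun x => (f x : ℝ≥0∞) := f.continuous.measurable.coe_nnreal_ennreal
  rw [restoreExpLaw, lintegral_map hfm hXT, lintegral_map hfm hm]
  have h1 := tendsto_lintegral_restorePath_gridAbove hκ' hloc' Pr hZ
    (ae_of_ae_map hZ.aemeasurable (hZlaw ▸ hgood)) hTn f
  have h2 := tendsto_lintegral_restorePath_gridAbove hκ' hloc' ((iidLaw Q).prod (expMeasure r))
    measurable_fst (Measure.quasiMeasurePreserving_fst.ae hgood) measurable_snd.real_toNNReal f
  refine tendsto_nhds_unique (h1.congr fun n => ?_) h2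
  -- At grid times evaluation uses countably many coordinates and is measurable for the product
  -- σ-algebra, so the joint law determines these integrals and hence their limit.
  have hg : Measurable fun p : (ℝ≥0 → E) × ℝ => (f (p.1 (gridAbove n p.2.toNNReal)) : ℝ≥0∞) := by
    have h3 := measurable_apply_gridAbove (X := fun t (x : ℝ≥0 → E) => x t)
      (fun t => measurable_pi_apply t) n
    have h4 : Measurable fun p : (ℝ≥0 → E) × ℝ => (p.1, p.2.toNNReal) := by fun_prop
    have h5 := hfm.comp (h3.comp h4)
    exact h5
  have h6 := congrArg (fun P : Measure ((ℝ≥0 → E) × ℝ) =>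
    ∫⁻ p, (f (p.1 (gridAbove n p.2.toNNReal)) : ℝ≥0∞) ∂P) hjoint
  rw [lintegral_map hg (hpathZ.prodMk hT), lintegral_map hg (hpath.prodMap measurable_id)] at h6
  exact h6

end ExponentialTime

/-! ### Coupling from the past -/

theorem IsRadonSpace.pseudoMetrizableSpace {E : Type*} [TopologicalSpace E]
    (hE : IsRadonSpace E) : TopologicalSpace.PseudoMetrizableSpace E := by
  obtain ⟨K, _, _, _, _, e, he, -⟩ := hE
  exact he.isInducing.pseudoMetrizableSpace

/-- The truncated subtraction in the modified rate is exact at almost every time along such a path.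
-/
theorem cumRate_eq_add {E : Type*} [TopologicalSpace E] (κ : E → ℝ≥0) (r : ℝ≥0) {y : RCPath E}
    (hy : ∀ᵐ t ∂(volume.restrict (Ici (0 : ℝ))), r ≤ κ (y.1 t.toNNReal)) (s : ℝ≥0) :
    cumRate κ y s = cumRate (fun x => κ x - r) y s + r * s := by
  have hs : ∀ᵐ t ∂(volume.restrict (Icc (0 : ℝ) s)), r ≤ κ (y.1 t.toNNReal) :=
    ae_restrict_of_ae_restrict_of_subset Icc_subset_Ici_self hy
  have h1 : cumRate κ y s =
      ∫⁻ t in Icc (0 : ℝ) s, (((κ (y.1 t.toNNReal) - r : ℝ≥0) : ℝ≥0∞) + r) := by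
    refine lintegral_congr_ae ?_
    filter_upwards [hs] with t ht
    rw [← ENNReal.coe_add, tsub_add_cancel_of_le ht]
  rw [h1, lintegral_add_right _ measurable_const]
  simp [cumRate]

/-- The accumulated rate grows at least at speed `r`, so it reaches ξ by time ξ / r. -/
theorem lifetime_ne_top {E : Type*} [TopologicalSpace E] {κ κ' : E → ℝ≥0} {r : ℝ≥0} (hr : 0 < r)
    {y : RCPath E} (hy : ∀ s, cumRate κ y s = cumRate κ' y s + r * s) (ξ : ℝ) :
    lifetime κ y ξ ≠ ∞ := by
  have h : ENNReal.ofReal ξ ≤ cumRate κ y (ξ.toNNReal / r) := by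
    rw [hy, ← ENNReal.coe_mul, mul_div_cancel₀ _ hr.ne']
    exact le_add_self
  exact ne_top_of_le_ne_top ENNReal.coe_ne_top (hittingTime_le h)

theorem mainTheorem5 {E : Type*} [TopologicalSpace E] [MeasurableSpace E] [BorelSpace E]
    (hE : IsRadonSpace E)
    (m : Measure E) [SigmaFinite m] [IsFiniteMeasureOnCompacts m] [m.InnerRegular]
    (Y : RightProcess E)
    (κ : E → ℝ≥0) (hκ : Measurable κ) (hκ_loc : ∀ x, ∃ U ∈ 𝓝 x, BddAbove (κ '' U))
    (μ : E → ℝ≥0) (hμ : Measurable μ) (hμ_one : ∫⁻ x, μ x ∂m = 1)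
    (ν : Measure E) (hν : ν = m.withDensity fun x => (μ x : ℝ≥0∞))
    (κlow : ℝ≥0) (hκlow : 0 < κlow) (hκ_ge : ∀ᵐ x ∂m, κlow ≤ κ x)
    -- the modified rate `κ - κlow` is nonnegative along the paths of `Y` started from `ν`
    (hκ_path : ∀ᵐ y ∂(Y.lawFrom ν), ∀ᵐ t ∂(volume.restrict (Ici (0 : ℝ))),
      κlow ≤ κ (y.1 t.toNNReal))
    (h_irr : IsRestoreIrreducible Y κ ν) :
    ∃ π : Measure E, IsProbabilityMeasure π ∧ IsRestoreInvariant Y κ ν π ∧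
      (∀ π' : Measure E, IsProbabilityMeasure π' → IsRestoreInvariant Y κ ν π' → π' = π) ∧
      ∀ (Ω : Type*) [MeasurableSpace Ω] (Pr : Measure Ω) [IsProbabilityMeasure Pr]
        (z : ℕ → Ω → RCPath E × ℝ) (X : ℝ≥0 → Ω → E) (T : Ω → ℝ),
        DrivesRestore Y ν Pr z →
        (∀ t ω, X t ω = restorePath (fun x => κ x - κlow) (fun i => z i ω) t) →
        Measurable T → Pr.map T = expMeasure κlow →
        IndepFun (fun ω t => X t ω) T Pr →
        Pr.map (fun ω => X (T ω).toNNReal ω) = π := by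
  have := hE.pseudoMetrizableSpace
  have hνp : IsProbabilityMeasure ν :=
    ⟨by rw [hν, withDensity_apply _ .univ, setLIntegral_univ, hμ_one]⟩
  have hQ := Y.isProbabilityMeasure_lawFrom ν
  have hκ' : Measurable fun x => κ x - κlow := hκ.sub measurable_const
  have hloc' : LocallyBounded fun x => κ x - κlow := fun x => by
    obtain ⟨U, hU, C, hC⟩ := hκ_loc x
    refine ⟨U, hU, C, ?_⟩
    rintro _ ⟨a, ha, rfl⟩
    exact tsub_le_self.trans (hC (mem_image_of_mem κ ha))
  have hrate : ∀ᵐ y ∂(Y.lawFrom ν), ∀ s,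
      cumRate κ y s = cumRate (fun x => κ x - κlow) y s + κlow * s := by
    filter_upwards [hκ_path] with y hy s using cumRate_eq_add κ κlow hy s
  obtain ⟨hfin, hprob, c, hc⟩ := restoreExpLaw_eq hκ hκ' hloc' hκlow (Y.lawFrom ν) hrate
  -- Invariance passes from the occupation measure to its multiple; the lower bound on the rate
  -- supplies the finite lifetimes.
  have hinv : IsRestoreInvariant Y κ ν
      (restoreExpLaw (fun x => κ x - κlow) (Y.lawFrom ν) κlow) := by
    intro t B hB
    have h := lintegral_restoreTransition_tourOccupation hκ hκ_loc Y ν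
      (hrate.mono fun y hy => Eventually.of_forall (lifetime_ne_top hκlow hy))
      (measurable_one.indicator hB) (fun x => indicator_le_self' (by simp) x) t
    simp_rw [lintegral_indicator_one hB] at h
    rw [hc, lintegral_smul_measure, h, Measure.smul_apply]
  refine ⟨_, hprob, hinv, fun π' _ hπ' => hπ'.unique hκ hκ_loc h_irr hinv, ?_⟩
  intro Ω _ Pr _ z X T hz hX hT hTlaw hind
  simp_rw [hX] at hind ⊢
  exact map_restorePath_exp_eq hκ' hloc' hκlow Y ν Pr hz hT hTlaw hind
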